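/- Let $f:\mathbb R^{m\times n}\to\mathbb R$ be differentiable and bounded below, put $r=\min\{m,n\}$, $f^*=\inf_W f(W)$, and let $W_0\in\mathbb R^{m\times n}$, $\Delta=f(W_0)-f^*$. Write $\|\cdot\|_*$, $\|\cdot\|_{\rm op}$, $\|\cdot\|_{\rm F}$ for the nuclear, spectral and Frobenius norms. Assume that for some $L_*>0$ $$\|\nabla f(W)-\nabla f(W')\|_*\le L_*\|W-W'\|_{\rm op}\qquad\text{for all }W,W'\in\mathbb R^{m\times n}.$$ In the stochastic setting assume moreover that, for a random sample $\xi$, the stochastic gradient $\nabla f(W;\xi)$ satisfies $\mathbb E[\nabla f(W;\xi)]=\nabla f(W)$ and $\mathbb E\|\nabla f(W;\xi)-\nabla f(W)\|_{\rm F}^2\le\sigma^2$ for all $W$, where $\sigma>0$. Muon with learning rate $\eta$, momentum parameter $\beta\in[0,1)$ and batch size $B$ performs, for $t=0,\dots,T-1$, where $T\ge 1$: $G_t=\frac1B\sum_{i=1}^B\nabla f(W_t;\xi_{t,i})$ with i.i.d. samples $\xi_{t,i}$ distributed as $\xi$ (in the deterministic setting $G_t=\nabla f(W_t)$); $M_0=G_0$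 and $M_t=\beta M_{t-1}+(1-\beta)G_t$ for $t>0$; $W_{t+1}=W_t-\eta U_tV_t^\top$, where $M_t=U_tS_tV_t^\top$ is a compact singular value decomposition (only the positive singular values are kept). 1. **Stochastic rate.** There is an absolute constant $C$ such that, for every $T\ge1$, if $B=1$, $1-\beta=\min\left\{\frac{\sqrt{L_*\Delta}}{\sigma\sqrt{rT}},1\right\}$ and $\eta=\sqrt{\frac{(1-\beta)\Delta}{TL_*}}$ (where $\Delta>0$, since $\beta<1$), then the expectations below are finite and $$\frac1T\sum_{t=0}^{T-1}\mathbb E\|\nabla f(W_t)\|_*\le C\left(\sqrt[4]{\frac{rL_*\Delta\sigma^2}{T}}+\sqrt{\frac{L_*\Delta}{T}}+\frac{r\sigma^2}{\sqrt{L_*\Delta T}}\right).$$ 2. **Deterministic rate.** For every $\beta_0<1$ there is a constant $C$ depending only on $\beta_0$ such that, for every $T\ge1$ and every $\beta\in[0,1)$ with $\beta\le\beta_0$, if $\eta=\sqrt{\frac{\Delta}{TL_*}}$, then $$\frac1T\sum_{t=0}^{T-1}\|\nabla f(W_t)\|_*\le C\sqrt{\frac{L_*\Delta}{T}}.$$ 3.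 **Stochastic complexity.** There is an absolute constant $C$ such that for every $0<\varepsilon\le\min\left\{\sigma\sqrt r,\frac{L_*\Delta}{\sigma\sqrt r}\right\}$ there is an integer $N$ with $1\le N\le C\,rL_*\sigma^2\Delta\varepsilon^{-4}$ such that for every $T\ge N$, $T$ iterations of Muon with the parameters of part 1 (one stochastic gradient per iteration) give $\frac1T\sum_{t=0}^{T-1}\mathbb E\|\nabla f(W_t)\|_*\le\varepsilon$, with finite expectations; in particular $\mathbb E\|\nabla f(W_t)\|_*\le\varepsilon$ for some $t<T$. 4. **Deterministic complexity.** For every $\beta_0<1$ there is a constant $C$ depending only on $\beta_0$ such that for every $\varepsilon>0$ there is an integer $N$ with $1\le N\le\max\{1,C\,L_*\Delta\varepsilon^{-2}\}$ such that for every $T\ge N$, $T$ iterations of Muon with the parameters of part 2 give $\frac1T\sum_{t=0}^{T-1}\|\nabla f(W_t)\|_*\le\varepsilon$; in particular $\|\nabla f(W_t)\|_*\le\varepsilon$ for some $t<T$, so that $W_t$ is an $\varepsilon$-nuclear norm stationary point of $f$. Constants depend on nothing but what is stated: not on $m,n,f,W_0,L_*,\sigma,T,\varepsilon$, nor on the distribution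 of the samples. -/

import Mathlib

open MeasureTheory ProbabilityTheory
open scoped Matrix

universe u v

/-- Matrices carry the product (equivalently, Borel) σ-algebra of their entries. -/
instance Muon.instMeasurableSpaceMatrix {m n α : Type*} [MeasurableSpace α] :
    MeasurableSpace (Matrix m n α) :=
  inferInstanceAs (MeasurableSpace (m → n → α))

namespace Muon

noncomputable section

/-- The nuclear norm `‖A‖_*`: the sum of the singular values of `A`. -/
def nuclearNorm {m n : ℕ} (A : Matrix (Fin m) (Fin n) ℝ) : ℝ :=
  (Matrix.toEuclideanLin A).singularValues.sum fun _ s => s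

/-- The spectral norm `‖A‖_op`: the operator norm of `A` for the Euclidean norms. -/
def opNorm {m n : ℕ} (A : Matrix (Fin m) (Fin n) ℝ) : ℝ :=
  ‖LinearMap.toContinuousLinearMap (Matrix.toEuclideanLin A)‖

/-- The Frobenius norm `‖A‖_F`. -/
def frobNorm {m n : ℕ} (A : Matrix (Fin m) (Fin n) ℝ) : ℝ :=
  letI := Matrix.frobeniusNormedAddCommGroup (m := Fin m) (n := Fin n) (α := ℝ)
  ‖A‖

/-- The gradient of `f : ℝ^{m×n} → ℝ`: the matrix of its partial derivatives. -/
def matGrad {m n : ℕ} (f : Matrix (Fin m) (Fin n) ℝ → ℝ) (W : Matrix (Fin m) (Fin n) ℝ) :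
    Matrix (Fin m) (Fin n) ℝ :=
  Matrix.of fun i j => fderiv ℝ f W (Matrix.single i j 1)

/-- `f` is differentiable and `L` spectral norm Lipschitz smooth:
`‖∇f(W) - ∇f(W')‖_* ≤ L ‖W - W'‖_op`. -/
structure IsSpectralSmooth {m n : ℕ} (f : Matrix (Fin m) (Fin n) ℝ → ℝ) (L : ℝ) : Prop where
  differentiable : Differentiable ℝ f
  gradient_le : ∀ W W' : Matrix (Fin m) (Fin n) ℝ,
    nuclearNorm (matGrad f W - matGrad f W') ≤ L * opNorm (W - W')

/-- The initial optimality gap `Δ = f(W₀) - inf f` (used for `f` bounded below). -/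
def gap {m n : ℕ} (f : Matrix (Fin m) (Fin n) ℝ → ℝ) (W₀ : Matrix (Fin m) (Fin n) ℝ) : ℝ :=
  f W₀ - ⨅ W, f W

/-- `W` is an `ε`-nuclear norm stationary point of `f`. -/
def IsNuclearStationary {m n : ℕ} (f : Matrix (Fin m) (Fin n) ℝ → ℝ) (ε : ℝ)
    (W : Matrix (Fin m) (Fin n) ℝ) : Prop :=
  nuclearNorm (matGrad f W) ≤ ε

/-- The bounded variance assumption: for a sample `x` with law `P`, the (jointly measurable)
stochastic gradient `g W x`, written `∇f(W; x)`, is an unbiased estimator of `∇f(W)` whose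
variance in Frobenius norm is at most `σ²`. -/
structure IsStochasticGradient {m n : ℕ} {Ξ : Type*} [MeasurableSpace Ξ] (P : Measure Ξ)
    (f : Matrix (Fin m) (Fin n) ℝ → ℝ)
    (g : Matrix (Fin m) (Fin n) ℝ → Ξ → Matrix (Fin m) (Fin n) ℝ) (σ : ℝ) : Prop where
  measurable : Measurable fun p : Matrix (Fin m) (Fin n) ℝ × Ξ => g p.1 p.2
  integrable : ∀ W i j, Integrable (fun x => g W x i j) P
  unbiased : ∀ W i j, ∫ x, g W x i j ∂P = matGrad f W i j
  integrable_sq : ∀ W, Integrable (fun x => frobNorm (g W x - matGrad f W) ^ 2) P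
  variance_le : ∀ W, ∫ x, frobNorm (g W x - matGrad f W) ^ 2 ∂P ≤ σ ^ 2

/-- A compact singular value decomposition `A = U diag(s) Vᵀ`: `U` and `V` have orthonormal columns
and `s` lists positive singular values, so that the inner dimension `k` is the rank of `A`. -/
structure IsCompactSVD {m n k : ℕ} (A : Matrix (Fin m) (Fin n) ℝ)
    (U : Matrix (Fin m) (Fin k) ℝ) (s : Fin k → ℝ) (V : Matrix (Fin n) (Fin k) ℝ) : Prop where
  left_orthonormal : Uᵀ * U = 1
  right_orthonormal : Vᵀ * V = 1
  pos : ∀ i, 0 < s i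
  eq_mul : A = U * Matrix.diagonal s * Vᵀ

/-- `T` iterations of Muon with constant learning rate `η` and momentum parameter `β`, started at
`W₀` and fed with the gradient estimates `G 0, …, G (T - 1)`: the momenta are
`M 0, …, M (T - 1)` and the iterates are `W 0, …, W T`. -/
structure IsMuonRun {m n : ℕ} (T : ℕ) (η β : ℝ) (W₀ : Matrix (Fin m) (Fin n) ℝ)
    (G M W : ℕ → Matrix (Fin m) (Fin n) ℝ) : Prop where
  init : W 0 = W₀
  momentum_zero : M 0 = G 0
  momentum_succ : ∀ t, t + 1 < T → M (t + 1) = β • M t + (1 - β) • G (t + 1)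
  step : ∀ t < T, ∃ (k : ℕ) (U : Matrix (Fin m) (Fin k) ℝ) (s : Fin k → ℝ)
    (V : Matrix (Fin n) (Fin k) ℝ),
      IsCompactSVD (M t) U s V ∧ W (t + 1) = W t - η • (U * Vᵀ)

/-- `T` iterations of Muon in the deterministic setting: `G t = ∇f(W t)`. -/
def IsDeterministicMuonRun {m n : ℕ} (f : Matrix (Fin m) (Fin n) ℝ → ℝ) (T : ℕ) (η β : ℝ)
    (W₀ : Matrix (Fin m) (Fin n) ℝ) (M W : ℕ → Matrix (Fin m) (Fin n) ℝ) : Prop :=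
  IsMuonRun T η β W₀ (fun t => matGrad f (W t)) M W

/-- `T` iterations of Muon in the stochastic setting with batch size `B`: the samples `ξ t i`,
`t < T`, `i < B`, are independent with law `P`, and `G t` is the average of the stochastic
gradients `g (W t) (ξ t i)` over the batch. -/
structure IsStochasticMuonRun {m n : ℕ} {Ξ Ω : Type*} [MeasurableSpace Ξ] [MeasurableSpace Ω]
    (P : Measure Ξ) (μ : Measure Ω)
    (g : Matrix (Fin m) (Fin n) ℝ → Ξ → Matrix (Fin m) (Fin n) ℝ) (T B : ℕ) (η β : ℝ)
    (W₀ : Matrix (Fin m) (Fin n) ℝ) (ξ : ℕ → Fin B → Ω → Ξ)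
    (M W : ℕ → Ω → Matrix (Fin m) (Fin n) ℝ) : Prop where
  sample_law : ∀ t < T, ∀ i, MeasurePreserving (ξ t i) μ P
  sample_indep : iIndepFun (fun p : Fin T × Fin B => ξ p.1 p.2) μ
  run : ∀ ω, IsMuonRun T η β W₀ (fun t => (B : ℝ)⁻¹ • ∑ i, g (W t ω) (ξ t i ω))
    (fun t => M t ω) (fun t => W t ω)

/-- The gradient norms `‖∇f(W_t)‖_*`, `t < T`, of the random iterates have finite expectation. -/
def HasFiniteExpectedGradients {m n : ℕ} {Ω : Type*} [MeasurableSpace Ω] (μ : Measure Ω)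
    (f : Matrix (Fin m) (Fin n) ℝ → ℝ) (T : ℕ) (W : ℕ → Ω → Matrix (Fin m) (Fin n) ℝ) : Prop :=
  ∀ t < T, Integrable (fun ω => nuclearNorm (matGrad f (W t ω))) μ

/-- `(1/T) ∑_{t < T} E ‖∇f(W_t)‖_*`. -/
def avgExpectedGradient {m n : ℕ} {Ω : Type*} [MeasurableSpace Ω] (μ : Measure Ω)
    (f : Matrix (Fin m) (Fin n) ℝ → ℝ) (T : ℕ) (W : ℕ → Ω → Matrix (Fin m) (Fin n) ℝ) : ℝ :=
  1 / (T : ℝ) * ∑ t ∈ Finset.range T, ∫ ω, nuclearNorm (matGrad f (W t ω)) ∂μ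

/-- `(1/T) ∑_{t < T} ‖∇f(W_t)‖_*`. -/
def avgGradient {m n : ℕ} (f : Matrix (Fin m) (Fin n) ℝ → ℝ) (T : ℕ)
    (W : ℕ → Matrix (Fin m) (Fin n) ℝ) : ℝ :=
  1 / (T : ℝ) * ∑ t ∈ Finset.range T, nuclearNorm (matGrad f (W t))

end

end Muon

/-! The nuclear and spectral norms are dual for the Frobenius pairing, and the polar factor `U * Vᵀ`
of the momentum has spectral norm at most 1 and attains the nuclear norm of the momentum. A Muon
step is therefore steepest descent for the spectral norm, with the momentum in place of the
gradient. By smoothness, `IsMuonRun.step_descent` shows that `f` drops by η‖∇f(W_t)‖_*, up to the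
losses 2η‖M_t - ∇f(W_t)‖_* and Lη².

The momentum error is split along each trajectory into drift and noise. The drift obeys a recursion
contracting by β and never exceeds βLη/(1-β) (`IsMuonRun.momentum_error_le`). The noise part is
`noiseMomentum`, the moving average of the gradient errors. Each new error has mean zero given the
past, so the squared Frobenius norms add without cross terms, and the mean square is at most (β^(2t)
+ 1 - β)σ² (`IsStochasticMuonRun.noiseMomentum_sq`). Passing from the Frobenius to the nuclear norm
costs √r. Telescoping and taking expectations gives `IsStochasticMuonRun.mul_sum_integral_le`;
inserting the parameters gives the stochastic rate. In the deterministic setting the noise part is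
zero. The complexities come from solving the rates for `T`.

One measure-theoretic point needs work: the singular value decompositions are arbitrary for each
sample point, so that measurability of the iterates is not automatic. The polar factor is recovered
as a limit of Newton–Schulz iterates, which are continuous functions of the momentum. -/

namespace Muon

/-! ### Duality of the nuclear and spectral norms, and the polar factor. -/

section LinearAlgebra

variable {m n k : ℕ}

/-- The Frobenius inner product of two real matrices. -/
def frobInner (A B : Matrix (Fin m) (Fin n) ℝ) : ℝ := ∑ i, ∑ j, A i j * B i j

theorem frobInner_add_left (A B C : Matrix (Fin m) (Fin n) ℝ) :
    frobInner (A + B) C = frobInner A C + frobInner B C := by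
  simp [frobInner, add_mul, Finset.sum_add_distrib]

theorem frobInner_sub_left (A B C : Matrix (Fin m) (Fin n) ℝ) :
    frobInner (A - B) C = frobInner A C - frobInner B C := by
  simp [frobInner, sub_mul, Finset.sum_sub_distrib]

theorem frobInner_smul_left (c : ℝ) (A B : Matrix (Fin m) (Fin n) ℝ) :
    frobInner (c • A) B = c * frobInner A B := by
  simp [frobInner, mul_assoc, Finset.mul_sum]

theorem frobInner_smul_right (c : ℝ) (A B : Matrix (Fin m) (Fin n) ℝ) :
    frobInner A (c • B) = c * frobInner A B := by
  simp [frobInner, mul_left_comm, Finset.mul_sum]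

theorem frobInner_neg_right (A B : Matrix (Fin m) (Fin n) ℝ) :
    frobInner A (-B) = -frobInner A B := by
  simp [frobInner]

theorem frobNorm_sq (A : Matrix (Fin m) (Fin n) ℝ) : frobNorm A ^ 2 = ∑ i, ∑ j, A i j ^ 2 := by
  have h : 0 ≤ ∑ i, ∑ j, A i j ^ 2 :=
    Finset.sum_nonneg fun i _ => Finset.sum_nonneg fun j _ => sq_nonneg _
  rw [frobNorm, Matrix.frobenius_norm_def]
  simp only [Real.norm_eq_abs, Real.rpow_two, sq_abs]
  rw [← Real.sqrt_eq_rpow, Real.sq_sqrt h]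

theorem frobNorm_nonneg (A : Matrix (Fin m) (Fin n) ℝ) : 0 ≤ frobNorm A := by
  let := Matrix.frobeniusNormedAddCommGroup (m := Fin m) (n := Fin n) (α := ℝ)
  exact norm_nonneg A

theorem frobInner_eq_trace (A B : Matrix (Fin m) (Fin n) ℝ) :
    frobInner A B = (Aᵀ * B).trace := by
  simp only [frobInner, Matrix.trace, Matrix.diag, Matrix.mul_apply, Matrix.transpose_apply]
  exact Finset.sum_comm

/-- Parseval applied to each pair of rows. The freedom in the basis is what matters: a singular
basis of `A` turns the pairing into a sum governed by the singular values. -/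
theorem frobInner_eq_sum_inner {ι : Type*} [Fintype ι] (A B : Matrix (Fin m) (Fin n) ℝ)
    (b : OrthonormalBasis ι ℝ (EuclideanSpace ℝ (Fin n))) :
    frobInner A B =
      ∑ l, inner ℝ (Matrix.toEuclideanLin A (b l)) (Matrix.toEuclideanLin B (b l)) := by
  have key : ∀ (C : Matrix (Fin m) (Fin n) ℝ) (x : EuclideanSpace ℝ (Fin n)) (i : Fin m),
      (Matrix.toEuclideanLin C x) i = inner ℝ (WithLp.toLp 2 (C i)) x := by
    intro C x i
    simp [Matrix.toLpLin_apply, Matrix.mulVec, dotProduct, PiLp.inner_apply, mul_comm]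
  have h1 : ∀ l, inner ℝ (Matrix.toEuclideanLin A (b l)) (Matrix.toEuclideanLin B (b l)) =
      ∑ i, inner ℝ (WithLp.toLp 2 (A i)) (b l) * inner ℝ (b l) (WithLp.toLp 2 (B i)) := by
    intro l
    rw [PiLp.inner_apply]
    refine Finset.sum_congr rfl fun i _ => ?_
    rw [key, key, real_inner_comm (b l) (WithLp.toLp 2 (B i))]
    simp [mul_comm]
  simp_rw [h1]
  rw [Finset.sum_comm]
  refine Finset.sum_congr rfl fun i _ => ?_
  rw [b.sum_inner_mul_inner]
  simp [PiLp.inner_apply, mul_comm]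

theorem opNorm_nonneg (A : Matrix (Fin m) (Fin n) ℝ) : 0 ≤ opNorm A := norm_nonneg _

theorem norm_toEuclideanLin_le (A : Matrix (Fin m) (Fin n) ℝ) (x : EuclideanSpace ℝ (Fin n)) :
    ‖Matrix.toEuclideanLin A x‖ ≤ opNorm A * ‖x‖ :=
  (LinearMap.toContinuousLinearMap (Matrix.toEuclideanLin A)).le_opNorm x

theorem opNorm_le_of_forall {A : Matrix (Fin m) (Fin n) ℝ} {c : ℝ} (hc : 0 ≤ c)
    (h : ∀ x, ‖Matrix.toEuclideanLin A x‖ ≤ c * ‖x‖) : opNorm A ≤ c :=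
  ContinuousLinearMap.opNorm_le_bound _ hc h

theorem opNorm_smul (c : ℝ) (A : Matrix (Fin m) (Fin n) ℝ) : opNorm (c • A) = |c| * opNorm A := by
  simp [opNorm, norm_smul]

theorem opNorm_sub_rev (A B : Matrix (Fin m) (Fin n) ℝ) : opNorm (A - B) = opNorm (B - A) := by
  rw [← neg_sub, ← neg_one_smul ℝ, opNorm_smul]; simp

theorem opNorm_add_le (A B : Matrix (Fin m) (Fin n) ℝ) : opNorm (A + B) ≤ opNorm A + opNorm B := by
  simp only [opNorm, map_add]; exact norm_add_le _ _

/-- A right singular basis: an orthonormal basis whose images under `A` are pairwise orthogonal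
with the singular values as norms. -/
theorem exists_right_singular_basis (A : Matrix (Fin m) (Fin n) ℝ) :
    ∃ b : OrthonormalBasis (Fin n) ℝ (EuclideanSpace ℝ (Fin n)),
      (∀ i, ‖Matrix.toEuclideanLin A (b i)‖ = (Matrix.toEuclideanLin A).singularValues i) ∧
      ∀ i j, i ≠ j →
        inner ℝ (Matrix.toEuclideanLin A (b i)) (Matrix.toEuclideanLin A (b j)) = 0 := by
  set T := Matrix.toEuclideanLin A with hT
  have hn : Module.finrank ℝ (EuclideanSpace ℝ (Fin n)) = n := by simp
  have hsym := T.isSymmetric_adjoint_comp_self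
  have hin : ∀ i j, inner ℝ (T (hsym.eigenvectorBasis hn i)) (T (hsym.eigenvectorBasis hn j)) =
      hsym.eigenvalues hn j *
        inner ℝ (hsym.eigenvectorBasis hn i) (hsym.eigenvectorBasis hn j) := by
    intro i j
    rw [← LinearMap.adjoint_inner_right]
    have := hsym.apply_eigenvectorBasis hn j
    rw [LinearMap.comp_apply] at this
    rw [this, inner_smul_right]
    simp
  refine ⟨hsym.eigenvectorBasis hn, fun i => ?_, fun i j hij => ?_⟩
  · rw [T.singularValues_fin hn i, ← Real.sqrt_sq (norm_nonneg _), ← real_inner_self_eq_norm_sq,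
      hin]
    simp
  · rw [hin, (hsym.eigenvectorBasis hn).orthonormal.2 hij, mul_zero]

theorem nuclearNorm_eq_sum (A : Matrix (Fin m) (Fin n) ℝ) :
    nuclearNorm A = ∑ i : Fin n, (Matrix.toEuclideanLin A).singularValues i := by
  rw [nuclearNorm, Fin.sum_univ_eq_sum_range (fun i => (Matrix.toEuclideanLin A).singularValues i)]
  refine Finsupp.sum_of_support_subset _ ?_ _ (by simp)
  rw [LinearMap.support_singularValues]
  refine Finset.range_subset_range.2 ?_
  simpa using LinearMap.finrank_range_le (Matrix.toEuclideanLin A)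

theorem nuclearNorm_nonneg (A : Matrix (Fin m) (Fin n) ℝ) : 0 ≤ nuclearNorm A := by
  rw [nuclearNorm_eq_sum]
  exact Finset.sum_nonneg fun i _ => LinearMap.singularValues_nonneg _ _

/-- Cauchy–Schwarz term by term in a right singular basis of `A`, where the images under `A` have
the singular values as norms. This is the easy half of the duality. -/
theorem frobInner_le_nuclearNorm_mul_opNorm (A O : Matrix (Fin m) (Fin n) ℝ) :
    frobInner A O ≤ nuclearNorm A * opNorm O := by
  obtain ⟨b, hb, -⟩ := exists_right_singular_basis A
  rw [frobInner_eq_sum_inner A O b, nuclearNorm_eq_sum, Finset.sum_mul]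
  refine Finset.sum_le_sum fun i _ => (real_inner_le_norm _ _).trans ?_
  rw [hb]
  refine mul_le_mul_of_nonneg_left ?_ (LinearMap.singularValues_nonneg _ _)
  simpa using norm_toEuclideanLin_le O (b i)

/-- The other half of the duality: the maximiser normalises the orthogonal images of a right
singular basis, so it is a partial isometry. The triangle inequality and homogeneity bound for the
nuclear norm are read off from this variational description. -/
theorem exists_frobInner_eq_nuclearNorm (A : Matrix (Fin m) (Fin n) ℝ) :
    ∃ O : Matrix (Fin m) (Fin n) ℝ, opNorm O ≤ 1 ∧ frobInner A O = nuclearNorm A := by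
  obtain ⟨b, hb, horth⟩ := exists_right_singular_basis A
  set T := Matrix.toEuclideanLin A with hT
  -- Since the inverse of 0 is 0, basis vectors in the kernel of `T` are sent to 0.
  let S := b.toBasis.constr ℝ (fun i => ‖T (b i)‖⁻¹ • T (b i))
  have hS : ∀ i, S (b i) = ‖T (b i)‖⁻¹ • T (b i) := by
    intro i
    rw [← b.coe_toBasis]
    exact b.toBasis.constr_basis ℝ _ i
  refine ⟨Matrix.toEuclideanLin.symm S, ?_, ?_⟩
  · refine opNorm_le_of_forall zero_le_one fun x => ?_
    rw [LinearEquiv.apply_symm_apply, one_mul]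
    refine le_of_sq_le_sq ?_ (norm_nonneg _)
    have hx : S x = ∑ i, inner ℝ (b i) x • S (b i) := by
      conv_lhs => rw [← b.sum_repr' x]
      simp
    have hin : ∀ i j, i ≠ j → inner ℝ (S (b i)) (S (b j)) = 0 := by
      intro i j hij
      rw [hS, hS, real_inner_smul_left, real_inner_smul_right, horth i j hij]; simp
    have hle : ∀ i, inner ℝ (S (b i)) (S (b i)) ≤ 1 := by
      intro i
      rw [hS, real_inner_self_eq_norm_sq, norm_smul, norm_inv, norm_norm]
      rcases eq_or_ne ‖T (b i)‖ 0 with h | h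
      · simp [h]
      · rw [inv_mul_cancel₀ h]; simp
    rw [← real_inner_self_eq_norm_sq, hx, sum_inner]
    simp_rw [inner_sum, real_inner_smul_left, real_inner_smul_right]
    rw [← b.sum_sq_norm_inner_right x]
    refine Finset.sum_le_sum fun i _ => ?_
    rw [Finset.sum_eq_single i (fun j _ hj => by rw [hin i j hj.symm]; ring) (by simp)]
    rw [Real.norm_eq_abs, sq_abs]
    nlinarith [hle i, sq_nonneg (inner ℝ (b i) x)]
  · rw [frobInner_eq_sum_inner _ _ b, nuclearNorm_eq_sum, LinearEquiv.apply_symm_apply]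
    refine Finset.sum_congr rfl fun i _ => ?_
    rw [hS, real_inner_smul_right, real_inner_self_eq_norm_sq, hb, ← hT]
    rcases eq_or_ne (T.singularValues i) 0 with h | h
    · simp [h]
    · field_simp

theorem nuclearNorm_add_le (A B : Matrix (Fin m) (Fin n) ℝ) :
    nuclearNorm (A + B) ≤ nuclearNorm A + nuclearNorm B := by
  obtain ⟨O, hO, h⟩ := exists_frobInner_eq_nuclearNorm (A + B)
  rw [← h, frobInner_add_left]
  refine add_le_add ((frobInner_le_nuclearNorm_mul_opNorm A O).trans ?_)
    ((frobInner_le_nuclearNorm_mul_opNorm B O).trans ?_)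
  · exact mul_le_of_le_one_right (nuclearNorm_nonneg A) hO
  · exact mul_le_of_le_one_right (nuclearNorm_nonneg B) hO

theorem nuclearNorm_smul_le (c : ℝ) (A : Matrix (Fin m) (Fin n) ℝ) :
    nuclearNorm (c • A) ≤ |c| * nuclearNorm A := by
  obtain ⟨O, hO, h⟩ := exists_frobInner_eq_nuclearNorm (c • A)
  rw [← h, frobInner_smul_left, ← frobInner_smul_right, mul_comm]
  refine (frobInner_le_nuclearNorm_mul_opNorm A _).trans ?_
  rw [opNorm_smul]
  refine mul_le_mul_of_nonneg_left ?_ (nuclearNorm_nonneg A)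
  exact mul_le_of_le_one_right (abs_nonneg c) hO

theorem nuclearNorm_sub_rev (A B : Matrix (Fin m) (Fin n) ℝ) :
    nuclearNorm (A - B) = nuclearNorm (B - A) := by
  have key : ∀ C : Matrix (Fin m) (Fin n) ℝ, nuclearNorm (-C) ≤ nuclearNorm C := fun C => by
    simpa using nuclearNorm_smul_le (-1) C
  refine le_antisymm ?_ ?_
  · simpa using key (B - A)
  · simpa using key (A - B)

theorem nuclearNorm_le_add_sub (A B : Matrix (Fin m) (Fin n) ℝ) :
    nuclearNorm A ≤ nuclearNorm B + nuclearNorm (A - B) := by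
  simpa using nuclearNorm_add_le B (A - B)

/-- Cauchy–Schwarz over the nonzero singular values only; their number is the rank, which is why
min(m, n) appears rather than `n`. -/
theorem nuclearNorm_le_sqrt_mul_frobNorm (A : Matrix (Fin m) (Fin n) ℝ) :
    nuclearNorm A ≤ √((min m n : ℕ) : ℝ) * frobNorm A := by
  obtain ⟨b, hb, -⟩ := exists_right_singular_basis A
  set T := Matrix.toEuclideanLin A with hT
  have hr : Module.finrank ℝ T.range ≤ min m n := by
    refine le_min ?_ ?_
    · simpa using Submodule.finrank_le T.range
    · simpa using LinearMap.finrank_range_le T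
  have hfrob : frobNorm A ^ 2 = ∑ i : Fin n, T.singularValues i ^ 2 := by
    have := frobInner_eq_sum_inner A A b
    simp only [real_inner_self_eq_norm_sq, ← hT, hb] at this
    rw [← this, frobNorm_sq, frobInner]
    simp [sq]
  have hsum : nuclearNorm A = ∑ i ∈ Finset.range (Module.finrank ℝ T.range), T.singularValues i := by
    rw [nuclearNorm, Finsupp.sum, LinearMap.support_singularValues]
  have hsub : ∑ i ∈ Finset.range (Module.finrank ℝ T.range), T.singularValues i ^ 2
      ≤ frobNorm A ^ 2 := by
    rw [hfrob, Fin.sum_univ_eq_sum_range (fun i => T.singularValues i ^ 2)]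
    refine Finset.sum_le_sum_of_subset_of_nonneg ?_ fun i _ _ => sq_nonneg _
    exact Finset.range_subset_range.2 (hr.trans (min_le_right _ _))
  refine le_of_sq_le_sq ?_ (mul_nonneg (Real.sqrt_nonneg _) (frobNorm_nonneg A))
  rw [mul_pow, Real.sq_sqrt (Nat.cast_nonneg _), hsum]
  refine sq_sum_le_card_mul_sum_sq.trans ?_
  rw [Finset.card_range]
  exact mul_le_mul (by exact_mod_cast hr) hsub (Finset.sum_nonneg fun _ _ => sq_nonneg _)
    (Nat.cast_nonneg _)

theorem norm_toEuclideanLin_of_transpose_mul_self {U : Matrix (Fin m) (Fin k) ℝ} (hU : Uᵀ * U = 1)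
    (x : EuclideanSpace ℝ (Fin k)) : ‖Matrix.toEuclideanLin U x‖ = ‖x‖ := by
  have h : ‖Matrix.toEuclideanLin U x‖ ^ 2 = ‖x‖ ^ 2 := by
    rw [EuclideanSpace.real_norm_sq_eq, EuclideanSpace.real_norm_sq_eq]
    have h1 : (U *ᵥ WithLp.ofLp x) ⬝ᵥ (U *ᵥ WithLp.ofLp x) = WithLp.ofLp x ⬝ᵥ WithLp.ofLp x := by
      rw [Matrix.dotProduct_mulVec, Matrix.vecMul_mulVec, hU]
      simp
    simpa [dotProduct, Matrix.toLpLin_apply, sq] using h1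
  exact (sq_eq_sq₀ (norm_nonneg _) (norm_nonneg _)).1 h

theorem norm_toEuclideanLin_transpose_le {V : Matrix (Fin n) (Fin k) ℝ} (hV : Vᵀ * V = 1)
    (x : EuclideanSpace ℝ (Fin n)) : ‖Matrix.toEuclideanLin Vᵀ x‖ ≤ ‖x‖ := by
  set y := Matrix.toEuclideanLin Vᵀ x with hy
  have h : inner ℝ y y = inner ℝ x (Matrix.toEuclideanLin V y) := by
    have : WithLp.ofLp y = Vᵀ *ᵥ WithLp.ofLp x := by simp [hy, Matrix.toLpLin_apply]
    simp only [EuclideanSpace.inner_eq_star_dotProduct, star_trivial, Matrix.toLpLin_apply]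
    conv_lhs => rw [dotProduct_comm]; arg 1; rw [this]
    rw [Matrix.mulVec_transpose, ← Matrix.dotProduct_mulVec, dotProduct_comm]
  have h2 : ‖y‖ * ‖y‖ ≤ ‖x‖ * ‖y‖ := by
    rw [← real_inner_self_eq_norm_mul_norm, h]
    refine (real_inner_le_norm _ _).trans ?_
    rw [norm_toEuclideanLin_of_transpose_mul_self hV]
  rcases (norm_nonneg y).eq_or_lt with h0 | h0
  · rw [← h0]; exact norm_nonneg x
  · exact le_of_mul_le_mul_right h2 h0

theorem IsCompactSVD.opNorm_le_one {A : Matrix (Fin m) (Fin n) ℝ} {U : Matrix (Fin m) (Fin k) ℝ}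
    {s : Fin k → ℝ} {V : Matrix (Fin n) (Fin k) ℝ} (h : IsCompactSVD A U s V) :
    opNorm (U * Vᵀ) ≤ 1 := by
  refine opNorm_le_of_forall zero_le_one fun x => ?_
  have : Matrix.toEuclideanLin (U * Vᵀ) x =
      Matrix.toEuclideanLin U (Matrix.toEuclideanLin Vᵀ x) := by
    simp [Matrix.toLpLin_apply]
  rw [this, norm_toEuclideanLin_of_transpose_mul_self h.left_orthonormal, one_mul]
  exact norm_toEuclideanLin_transpose_le h.right_orthonormal x

theorem IsCompactSVD.frobInner_eq {A : Matrix (Fin m) (Fin n) ℝ} {U : Matrix (Fin m) (Fin k) ℝ}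
    {s : Fin k → ℝ} {V : Matrix (Fin n) (Fin k) ℝ} (h : IsCompactSVD A U s V)
    (O : Matrix (Fin m) (Fin n) ℝ) : frobInner A O = ∑ i, s i * (Uᵀ * O * V) i i := by
  rw [frobInner_eq_trace, h.eq_mul, Matrix.transpose_mul, Matrix.transpose_mul,
    Matrix.transpose_transpose, Matrix.diagonal_transpose, Matrix.mul_assoc, Matrix.trace_mul_comm]
  simp [Matrix.trace, Matrix.mul_assoc]

/-- The pairing with any `O` is the `s`-weighted sum of the diagonal of `Uᵀ * O * V`. Those entries
are at most 1 when `opNorm O ≤ 1`, and all equal 1 at the polar factor, so the polar factor does at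
least as well as the maximiser from duality. -/
theorem IsCompactSVD.nuclearNorm_le_frobInner {A : Matrix (Fin m) (Fin n) ℝ}
    {U : Matrix (Fin m) (Fin k) ℝ} {s : Fin k → ℝ} {V : Matrix (Fin n) (Fin k) ℝ}
    (h : IsCompactSVD A U s V) : nuclearNorm A ≤ frobInner A (U * Vᵀ) := by
  obtain ⟨O, hO, hA⟩ := exists_frobInner_eq_nuclearNorm A
  have h1 : Uᵀ * (U * Vᵀ) * V = 1 := by
    rw [← Matrix.mul_assoc, h.left_orthonormal, Matrix.one_mul, h.right_orthonormal]
  rw [← hA, h.frobInner_eq, h.frobInner_eq, h1]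
  refine Finset.sum_le_sum fun i _ => mul_le_mul_of_nonneg_left ?_ (h.pos i).le
  rw [Matrix.one_apply_eq]
  set e : EuclideanSpace ℝ (Fin k) := EuclideanSpace.single i 1 with he
  have h2 : (Uᵀ * O * V) i i =
      inner ℝ e (Matrix.toEuclideanLin Uᵀ (Matrix.toEuclideanLin O (Matrix.toEuclideanLin V e))) := by
    simp [he, Matrix.toLpLin_apply, EuclideanSpace.inner_single_left]
    rfl
  have hne : ‖e‖ = 1 := by simp [he]
  rw [h2]
  refine (real_inner_le_norm _ _).trans ?_
  rw [hne, one_mul]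
  refine (norm_toEuclideanLin_transpose_le h.left_orthonormal _).trans ?_
  refine (norm_toEuclideanLin_le O _).trans ?_
  rw [norm_toEuclideanLin_of_transpose_mul_self h.right_orthonormal, hne, mul_one]
  exact hO

end LinearAlgebra

/-! ### Measurability of the polar factor through Newton–Schulz iteration. -/

section PolarFactor

open Filter Topology

variable {m n k : ℕ}

instance instBorelSpaceMatrix : BorelSpace (Matrix (Fin m) (Fin n) ℝ) :=
  inferInstanceAs (BorelSpace (Fin m → Fin n → ℝ))

instance instPseudoMetrizableSpaceMatrix :
    TopologicalSpace.PseudoMetrizableSpace (Matrix (Fin m) (Fin n) ℝ) :=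
  inferInstanceAs (TopologicalSpace.PseudoMetrizableSpace (Fin m → Fin n → ℝ))

/-- The iterates stay in [x, 1], and 1 - φ(y) = (1 - y)(1 - y/2 - y²/2) shows that the distance to
the fixed point 1 shrinks by at least the factor 1 - x/2 each time. -/
theorem tendsto_iterate_cubic {x : ℝ} (hx0 : 0 < x) (hx1 : x ≤ 1) :
    Tendsto (fun N => (fun y : ℝ => 3 / 2 * y - 1 / 2 * y ^ 3)^[N] x) atTop (𝓝 1) := by
  set φ : ℝ → ℝ := fun y => 3 / 2 * y - 1 / 2 * y ^ 3 with hφ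
  have key : ∀ N, x ≤ φ^[N] x ∧ φ^[N] x ≤ 1 ∧ 1 - φ^[N] x ≤ (1 - x / 2) ^ N := by
    intro N
    induction N with
    | zero => simp [hx1, hx0.le]
    | succ N ih =>
      obtain ⟨h1, h2, h3⟩ := ih
      rw [Function.iterate_succ_apply']
      set y := φ^[N] x
      have hy : 0 < y := hx0.trans_le h1
      have e : 1 - φ y = (1 - y) * (1 - y / 2 - y ^ 2 / 2) := by simp only [hφ]; ring
      refine ⟨?_, ?_, ?_⟩
      · have : 0 ≤ y * (1 - y) * (1 + y) :=
          mul_nonneg (mul_nonneg hy.le (by linarith)) (by linarith)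
        simp only [hφ]; nlinarith
      · have : 0 ≤ (1 - y) * (1 - y / 2 - y ^ 2 / 2) :=
          mul_nonneg (by linarith) (by nlinarith)
        linarith
      · rw [e, pow_succ]
        refine mul_le_mul h3 (by nlinarith) (by nlinarith) (pow_nonneg (by linarith) _)
  have hlim : Tendsto (fun N : ℕ => 1 - (1 - x / 2) ^ N) atTop (𝓝 1) := by
    simpa using (tendsto_pow_atTop_nhds_zero_of_lt_one (by linarith : (0 : ℝ) ≤ 1 - x / 2)
      (by linarith)).const_sub 1
  exact tendsto_of_tendsto_of_tendsto_of_le_of_le hlim tendsto_const_nhds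
    (fun N => by have := (key N).2.2; linarith) (fun N => (key N).2.1)

/-- The cubic Newton–Schulz map, which acts on the singular values by `y ↦ (3 y - y ^ 3) / 2`. -/
noncomputable def newtonSchulz (X : Matrix (Fin m) (Fin n) ℝ) : Matrix (Fin m) (Fin n) ℝ :=
  (3 / 2 : ℝ) • X - (1 / 2 : ℝ) • (X * Xᵀ * X)

theorem continuous_newtonSchulz :
    Continuous (newtonSchulz : Matrix (Fin m) (Fin n) ℝ → Matrix (Fin m) (Fin n) ℝ) := by
  unfold newtonSchulz; fun_prop

/-- Newton–Schulz iterations started at a rescaling of `A`. -/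
noncomputable def polarIterate (N : ℕ) (A : Matrix (Fin m) (Fin n) ℝ) : Matrix (Fin m) (Fin n) ℝ :=
  newtonSchulz^[N] ((1 + frobInner A A)⁻¹ • A)

theorem frobInner_self_nonneg (A : Matrix (Fin m) (Fin n) ℝ) : 0 ≤ frobInner A A :=
  Finset.sum_nonneg fun _ _ => Finset.sum_nonneg fun _ _ => mul_self_nonneg _

theorem measurable_polarIterate (N : ℕ) :
    Measurable (polarIterate N : Matrix (Fin m) (Fin n) ℝ → Matrix (Fin m) (Fin n) ℝ) := by
  refine Continuous.measurable ((continuous_newtonSchulz.iterate N).comp ?_)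
  have h : Continuous fun A : Matrix (Fin m) (Fin n) ℝ => frobInner A A := by
    unfold frobInner; fun_prop
  refine Continuous.smul (Continuous.inv₀ (continuous_const.add h) fun A => ?_) continuous_id
  exact (add_pos_of_pos_of_nonneg one_pos (frobInner_self_nonneg A)).ne'

theorem newtonSchulz_mul {U : Matrix (Fin m) (Fin k) ℝ} {V : Matrix (Fin n) (Fin k) ℝ}
    (hU : Uᵀ * U = 1) (hV : Vᵀ * V = 1) (d : Fin k → ℝ) :
    newtonSchulz (U * Matrix.diagonal d * Vᵀ) =
      U * Matrix.diagonal (fun i => 3 / 2 * d i - 1 / 2 * d i ^ 3) * Vᵀ := by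
  have h : U * Matrix.diagonal d * Vᵀ * (U * Matrix.diagonal d * Vᵀ)ᵀ *
      (U * Matrix.diagonal d * Vᵀ) = U * Matrix.diagonal (fun i => d i ^ 3) * Vᵀ := by
    calc _ = U * (Matrix.diagonal d * (Vᵀ * V) * Matrix.diagonal d * (Uᵀ * U) *
          Matrix.diagonal d) * Vᵀ := by
          simp only [Matrix.transpose_mul, Matrix.transpose_transpose, Matrix.diagonal_transpose,
            Matrix.mul_assoc]
      _ = _ := by
          rw [hU, hV]
          simp only [Matrix.mul_one, Matrix.diagonal_mul_diagonal]
          congr 4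
          ext i; ring
  have h2 : Matrix.diagonal (fun i => 3 / 2 * d i - 1 / 2 * d i ^ 3) =
      (3 / 2 : ℝ) • Matrix.diagonal d - (1 / 2 : ℝ) • Matrix.diagonal (fun i => d i ^ 3) := by
    rw [← Matrix.diagonal_smul, ← Matrix.diagonal_smul, Matrix.diagonal_sub]
    rfl
  rw [newtonSchulz, h, h2]
  simp only [Matrix.mul_sub, Matrix.sub_mul, Matrix.mul_smul, Matrix.smul_mul]

/-- The iteration keeps `U` and `V` and moves each positive singular value to 1. The iterates depend
on `A` alone, so the limit is the same for every compact decomposition. -/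
theorem IsCompactSVD.tendsto_polarIterate {A : Matrix (Fin m) (Fin n) ℝ}
    {U : Matrix (Fin m) (Fin k) ℝ} {s : Fin k → ℝ} {V : Matrix (Fin n) (Fin k) ℝ}
    (h : IsCompactSVD A U s V) :
    Tendsto (fun N => polarIterate N A) atTop (𝓝 (U * Vᵀ)) := by
  set c := (1 + frobInner A A)⁻¹ with hc
  set φ : ℝ → ℝ := fun y => 3 / 2 * y - 1 / 2 * y ^ 3 with hφ
  have hA : frobInner A A = ∑ i, s i ^ 2 := by
    rw [h.frobInner_eq]
    refine Finset.sum_congr rfl fun i _ => ?_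
    have : Uᵀ * A * V = Matrix.diagonal s := by
      calc Uᵀ * A * V = (Uᵀ * U) * Matrix.diagonal s * (Vᵀ * V) := by
            conv_lhs => rw [h.eq_mul]
            simp only [Matrix.mul_assoc]
        _ = _ := by rw [h.left_orthonormal, h.right_orthonormal]; simp
    rw [this, Matrix.diagonal_apply_eq, sq]
  have hpos : 0 < 1 + frobInner A A := by have := frobInner_self_nonneg A; positivity
  have hform : ∀ N, polarIterate N A = U * Matrix.diagonal (fun i => φ^[N] (c * s i)) * Vᵀ := by
    intro N
    induction N with
    | zero =>
      have : Matrix.diagonal (fun i => c * s i) = c • Matrix.diagonal s := by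
        rw [← Matrix.diagonal_smul]; rfl
      simp only [polarIterate, Function.iterate_zero, id, this, ← hc]
      conv_lhs => rw [h.eq_mul]
      simp only [Matrix.mul_smul, Matrix.smul_mul]
    | succ N ih =>
      rw [polarIterate, Function.iterate_succ_apply', ← polarIterate, ih,
        newtonSchulz_mul h.left_orthonormal h.right_orthonormal]
      simp only [Function.iterate_succ_apply']
      rfl
  have hlim : Tendsto (fun N i => φ^[N] (c * s i)) atTop (𝓝 (fun _ : Fin k => (1 : ℝ))) := by
    refine tendsto_pi_nhds.2 fun i => tendsto_iterate_cubic ?_ ?_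
    · exact mul_pos (inv_pos.2 hpos) (h.pos i)
    -- The rescaling by 1 + ‖A‖_F² puts every singular value in (0, 1], because s ≤ 1 + s².
    · rw [hc, inv_mul_le_one₀ hpos, hA]
      have : s i ^ 2 ≤ ∑ i, s i ^ 2 :=
        Finset.single_le_sum (f := fun i => s i ^ 2) (fun _ _ => sq_nonneg _) (Finset.mem_univ i)
      nlinarith [sq_nonneg (s i - 1), h.pos i]
  have hcont : Continuous fun d : Fin k → ℝ => U * Matrix.diagonal d * Vᵀ := by fun_prop
  simp_rw [hform]
  have := (hcont.tendsto _).comp hlim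
  simpa [Function.comp_def] using this

/-- No measurable choice of `U`, `s`, `V` is needed: their product is a pointwise limit of
measurable functions of `M`. -/
theorem measurable_of_isCompactSVD {Ω : Type*} [MeasurableSpace Ω]
    {M O : Ω → Matrix (Fin m) (Fin n) ℝ} (hM : Measurable M)
    (h : ∀ ω, ∃ (k : ℕ) (U : Matrix (Fin m) (Fin k) ℝ) (s : Fin k → ℝ)
      (V : Matrix (Fin n) (Fin k) ℝ), IsCompactSVD (M ω) U s V ∧ O ω = U * Vᵀ) :
    Measurable O := by
  refine measurable_of_tendsto_metrizable (f := fun N ω => polarIterate N (M ω))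
    (fun N => (measurable_polarIterate N).comp hM) ?_
  refine tendsto_pi_nhds.2 fun ω => ?_
  obtain ⟨k, U, s, V, hsvd, hO⟩ := h ω
  rw [hO]
  exact hsvd.tendsto_polarIterate

end PolarFactor

/-! ### Gradient, descent inequality and continuity under spectral smoothness. -/

section Descent

open Filter Topology

variable {m n : ℕ}

theorem frobInner_matGrad (f : Matrix (Fin m) (Fin n) ℝ → ℝ) (W D : Matrix (Fin m) (Fin n) ℝ) :
    frobInner (matGrad f W) D = fderiv ℝ f W D := by
  conv_rhs => rw [Matrix.matrix_eq_sum_single D]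
  simp only [map_sum, frobInner, matGrad, Matrix.of_apply]
  refine Finset.sum_congr rfl fun i _ => Finset.sum_congr rfl fun j _ => ?_
  have : Matrix.single i j (D i j) = D i j • Matrix.single i j (1 : ℝ) := by simp
  rw [this, map_smul, smul_eq_mul, mul_comm]

theorem nuclearNorm_zero : nuclearNorm (0 : Matrix (Fin m) (Fin n) ℝ) = 0 := by
  simp [nuclearNorm]

attribute [local instance] Matrix.normedAddCommGroup Matrix.normedSpace in
theorem hasDerivAt_line {f : Matrix (Fin m) (Fin n) ℝ → ℝ} (hf : Differentiable ℝ f)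
    (W D : Matrix (Fin m) (Fin n) ℝ) (s : ℝ) :
    HasDerivAt (fun s : ℝ => f (W + s • D)) (frobInner (matGrad f (W + s • D)) D) s := by
  rw [frobInner_matGrad]
  have h1 : HasDerivAt (fun s : ℝ => W + s • D) D s := by
    have h := ((hasDerivAt_id s).smul_const D).const_add W
    rw [one_smul] at h
    exact h
  exact (hf (W + s • D)).hasFDerivAt.comp_hasDerivAt s h1

attribute [local instance] Matrix.normedAddCommGroup Matrix.normedSpace in
theorem matGrad_eq_zero_of_forall_le {f : Matrix (Fin m) (Fin n) ℝ → ℝ}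
    {W : Matrix (Fin m) (Fin n) ℝ} (h : ∀ W', f W ≤ f W') : matGrad f W = 0 := by
  have h0 : fderiv ℝ f W = 0 := IsLocalMin.fderiv_eq_zero (Filter.Eventually.of_forall h)
  ext i j
  simp [matGrad, h0]

/-- The mean value theorem on the segment gives one intermediate gradient, compared with the
gradient at `W` by duality and smoothness. The constant is `L` instead of the L/2 that integration
would give; only absolute constants are affected. -/
theorem IsSpectralSmooth.descent {f : Matrix (Fin m) (Fin n) ℝ → ℝ} {L : ℝ}
    (hf : IsSpectralSmooth f L) (hL : 0 ≤ L) (W D : Matrix (Fin m) (Fin n) ℝ) :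
    f (W + D) ≤ f W + frobInner (matGrad f W) D + L * opNorm D ^ 2 := by
  have hd := hasDerivAt_line hf.differentiable W D
  obtain ⟨s, ⟨hs0, hs1⟩, hs⟩ := exists_hasDerivAt_eq_slope (fun s : ℝ => f (W + s • D)) _ zero_lt_one
    (fun s _ => (hd s).continuousAt.continuousWithinAt) (fun s _ => hd s)
  simp only [one_smul, zero_smul, add_zero, sub_zero, div_one] at hs
  have h1 := frobInner_le_nuclearNorm_mul_opNorm (matGrad f (W + s • D) - matGrad f W) D
  have h2 := hf.gradient_le (W + s • D) W
  rw [add_sub_cancel_left, opNorm_smul, abs_of_pos hs0] at h2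
  rw [frobInner_sub_left, hs] at h1
  have h3 := mul_le_mul_of_nonneg_right h2 (opNorm_nonneg D)
  have h4 : s * (L * opNorm D ^ 2) ≤ 1 * (L * opNorm D ^ 2) :=
    mul_le_mul_of_nonneg_right hs1.le (mul_nonneg hL (sq_nonneg _))
  nlinarith

theorem continuous_opNorm :
    Continuous (opNorm : Matrix (Fin m) (Fin n) ℝ → ℝ) := by
  let Φ : Matrix (Fin m) (Fin n) ℝ →ₗ[ℝ]
      (EuclideanSpace ℝ (Fin n) →L[ℝ] EuclideanSpace ℝ (Fin m)) :=
    LinearMap.toContinuousLinearMap.toLinearMap ∘ₗ Matrix.toEuclideanLin.toLinearMap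
  exact continuous_norm.comp Φ.continuous_of_finiteDimensional

theorem tendsto_opNorm_sub (W : Matrix (Fin m) (Fin n) ℝ) (L : ℝ) :
    Tendsto (fun W' => L * opNorm (W' - W)) (𝓝 W) (𝓝 0) := by
  have h : Continuous fun W' => L * opNorm (W' - W) :=
    continuous_const.mul (continuous_opNorm.comp (continuous_id.sub continuous_const))
  have := h.tendsto W
  simpa [opNorm] using this

theorem IsSpectralSmooth.continuous_matGrad {f : Matrix (Fin m) (Fin n) ℝ → ℝ} {L : ℝ}
    (hf : IsSpectralSmooth f L) : Continuous (matGrad f) := by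
  refine continuous_pi fun i => continuous_pi fun j => ?_
  -- An entry is the pairing with a matrix unit, so the nuclear norm controls it up to a constant.
  have hentry : ∀ A : Matrix (Fin m) (Fin n) ℝ,
      A i j ≤ nuclearNorm A * opNorm (Matrix.single i j (1 : ℝ) : Matrix (Fin m) (Fin n) ℝ) := by
    intro A
    refine le_trans (le_of_eq ?_) (frobInner_le_nuclearNorm_mul_opNorm A _)
    rw [frobInner, Finset.sum_eq_single i, Finset.sum_eq_single j]
    · simp
    · intro b _ hb; simp [hb.symm]
    · simp
    · intro b _ hb; simp [hb.symm]
    · simp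
  set c := opNorm (Matrix.single i j (1 : ℝ) : Matrix (Fin m) (Fin n) ℝ)
  rw [continuous_iff_continuousAt]
  intro W
  rw [ContinuousAt, tendsto_iff_norm_sub_tendsto_zero]
  have hlim := (tendsto_opNorm_sub W L).mul_const c
  rw [zero_mul] at hlim
  refine squeeze_zero (fun _ => norm_nonneg _) (fun W' => ?_) hlim
  have hg := mul_le_mul_of_nonneg_right (hf.gradient_le W' W) (opNorm_nonneg _ : 0 ≤ c)
  rw [Real.norm_eq_abs, abs_le]
  have h1 := hentry (matGrad f W' - matGrad f W)
  have h2 := hentry (matGrad f W - matGrad f W')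
  rw [nuclearNorm_sub_rev] at h2
  simp only [Matrix.sub_apply] at h1 h2
  constructor <;> linarith

theorem IsSpectralSmooth.continuous_nuclearNorm_matGrad {f : Matrix (Fin m) (Fin n) ℝ → ℝ} {L : ℝ}
    (hf : IsSpectralSmooth f L) : Continuous fun W => nuclearNorm (matGrad f W) := by
  rw [continuous_iff_continuousAt]
  intro W
  rw [ContinuousAt, tendsto_iff_norm_sub_tendsto_zero]
  refine squeeze_zero (fun _ => norm_nonneg _) (fun W' => ?_) (tendsto_opNorm_sub W L)
  have hg := hf.gradient_le W' W
  have h1 := nuclearNorm_le_add_sub (matGrad f W') (matGrad f W)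
  have h2 := nuclearNorm_le_add_sub (matGrad f W) (matGrad f W')
  rw [nuclearNorm_sub_rev (matGrad f W)] at h2
  rw [Real.norm_eq_abs, abs_le]
  constructor <;> linarith

end Descent

/-! ### Estimates along a single trajectory. -/

section Run

variable {m n T : ℕ} {f : Matrix (Fin m) (Fin n) ℝ → ℝ} {L η β : ℝ}
  {W₀ : Matrix (Fin m) (Fin n) ℝ} {G M W : ℕ → Matrix (Fin m) (Fin n) ℝ}

theorem gap_nonneg (hb : BddBelow (Set.range f)) (W₀ : Matrix (Fin m) (Fin n) ℝ) :
    0 ≤ gap f W₀ := sub_nonneg.2 (ciInf_le hb W₀)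

/-- The exponential moving average of the gradient noise. -/
def noiseMomentum (β : ℝ) (Z : ℕ → Matrix (Fin m) (Fin n) ℝ) : ℕ → Matrix (Fin m) (Fin n) ℝ
  | 0 => Z 0
  | t + 1 => β • noiseMomentum β Z t + (1 - β) • Z (t + 1)

theorem IsMuonRun.opNorm_step_le (h : IsMuonRun T η β W₀ G M W) (hη : 0 ≤ η) {t : ℕ}
    (ht : t < T) : opNorm (W (t + 1) - W t) ≤ η := by
  obtain ⟨k, U, s, V, hsvd, hW⟩ := h.step t ht
  rw [hW, opNorm_sub_rev, sub_sub_cancel, opNorm_smul, abs_of_nonneg hη]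
  exact mul_le_of_le_one_right hη hsvd.opNorm_le_one

theorem IsMuonRun.opNorm_sub_init_le (h : IsMuonRun T η β W₀ G M W) (hη : 0 ≤ η) :
    ∀ t ≤ T, opNorm (W t - W₀) ≤ t * η := by
  intro t
  induction t with
  | zero => intro _; simp [h.init, opNorm]
  | succ t ih =>
    intro ht
    have h1 := ih (by omega)
    have h2 := h.opNorm_step_le hη (t := t) (by omega)
    have h3 := opNorm_add_le (W (t + 1) - W t) (W t - W₀)
    rw [sub_add_sub_cancel] at h3
    push_cast
    linarith

/-- The momentum error enters twice, hence the factor 2: once when the pairing of the gradient with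
the polar factor is replaced by that of the momentum, once when ‖M_t‖_* is traded back for the
gradient norm. -/
theorem IsMuonRun.step_descent (h : IsMuonRun T η β W₀ G M W) (hf : IsSpectralSmooth f L)
    (hL : 0 ≤ L) (hη : 0 ≤ η) {t : ℕ} (ht : t < T) :
    f (W (t + 1)) ≤ f (W t) - η * nuclearNorm (matGrad f (W t))
      + 2 * η * nuclearNorm (M t - matGrad f (W t)) + L * η ^ 2 := by
  have hstep := h.opNorm_step_le hη ht
  obtain ⟨k, U, s, V, hsvd, hW⟩ := h.step t ht
  set O := U * Vᵀ
  have hO : opNorm O ≤ 1 := hsvd.opNorm_le_one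
  have hD : W (t + 1) - W t = -(η • O) := by rw [hW]; abel
  have h1 := hf.descent hL (W t) (W (t + 1) - W t)
  have h2 : L * opNorm (W (t + 1) - W t) ^ 2 ≤ L * η ^ 2 :=
    mul_le_mul_of_nonneg_left (pow_le_pow_left₀ (opNorm_nonneg _) hstep 2) hL
  rw [add_sub_cancel, hD, frobInner_neg_right, frobInner_smul_right, ← hD] at h1
  have h3 := hsvd.nuclearNorm_le_frobInner
  have h4 : frobInner (M t - matGrad f (W t)) O ≤ nuclearNorm (M t - matGrad f (W t)) :=
    (frobInner_le_nuclearNorm_mul_opNorm _ _).trans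
      (mul_le_of_le_one_right (nuclearNorm_nonneg _) hO)
  rw [frobInner_sub_left] at h4
  have h5 := nuclearNorm_le_add_sub (matGrad f (W t)) (M t)
  rw [nuclearNorm_sub_rev] at h5
  have h6 : nuclearNorm (matGrad f (W t)) - 2 * nuclearNorm (M t - matGrad f (W t)) ≤
      frobInner (matGrad f (W t)) O := by linarith
  have h7 := mul_le_mul_of_nonneg_left h6 hη
  linarith

/-- With the averaged noise removed, the error obeys e_{t+1} = β(e_t + ∇f(W_t) - ∇f(W_{t+1})),
starts at 0, and each gradient change is at most Lη. The bound is the fixed point of x = β(x + Lη).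
It holds for any `G`, with no probability involved. -/
theorem IsMuonRun.momentum_error_le (h : IsMuonRun T η β W₀ G M W) (hf : IsSpectralSmooth f L)
    (hL : 0 ≤ L) (hη : 0 ≤ η) (hβ0 : 0 ≤ β) (hβ1 : β < 1) :
    ∀ t < T, nuclearNorm (M t - matGrad f (W t)
      - noiseMomentum β (fun t => G t - matGrad f (W t)) t) ≤ β * L * η / (1 - β) := by
  have h1β : 0 < 1 - β := sub_pos.2 hβ1
  intro t
  induction t with
  | zero =>
    intro _
    rw [noiseMomentum, h.momentum_zero, sub_self, nuclearNorm_zero]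
    positivity
  | succ t ih =>
    intro ht
    have h1 := ih (by omega)
    set N := noiseMomentum β (fun t => G t - matGrad f (W t)) with hN
    have hNs : N (t + 1) = β • N t + (1 - β) • (G (t + 1) - matGrad f (W (t + 1))) := rfl
    have hrec : M (t + 1) - matGrad f (W (t + 1)) - N (t + 1) =
        β • ((M t - matGrad f (W t) - N t) + (matGrad f (W t) - matGrad f (W (t + 1)))) := by
      rw [hNs, h.momentum_succ t ht]
      module
    have h2 : nuclearNorm (matGrad f (W t) - matGrad f (W (t + 1))) ≤ L * η := by
      rw [nuclearNorm_sub_rev]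
      exact (hf.gradient_le _ _).trans
        (mul_le_mul_of_nonneg_left (h.opNorm_step_le hη (by omega)) hL)
    rw [hrec]
    refine (nuclearNorm_smul_le _ _).trans ?_
    rw [abs_of_nonneg hβ0]
    refine (mul_le_mul_of_nonneg_left ((nuclearNorm_add_le _ _).trans (add_le_add h1 h2))
      hβ0).trans (le_of_eq ?_)
    field_simp
    ring

theorem IsMuonRun.sum_nuclearNorm_le (h : IsMuonRun T η β W₀ G M W) (hf : IsSpectralSmooth f L)
    (hL : 0 ≤ L) (hη : 0 ≤ η) (hβ0 : 0 ≤ β) (hβ1 : β < 1) (hb : BddBelow (Set.range f)) :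
    η * ∑ t ∈ Finset.range T, nuclearNorm (matGrad f (W t)) ≤
      gap f W₀ + 2 * η * ∑ t ∈ Finset.range T,
        nuclearNorm (noiseMomentum β (fun t => G t - matGrad f (W t)) t)
      + T * (2 * η * (β * L * η / (1 - β)) + L * η ^ 2) := by
  set N := noiseMomentum β (fun t => G t - matGrad f (W t)) with hN
  have key : ∀ k ≤ T, η * ∑ t ∈ Finset.range k, nuclearNorm (matGrad f (W t)) ≤
      f W₀ - f (W k) + 2 * η * ∑ t ∈ Finset.range k, nuclearNorm (N t)
      + k * (2 * η * (β * L * η / (1 - β)) + L * η ^ 2) := by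
    intro k
    induction k with
    | zero => intro _; simp [h.init]
    | succ k ih =>
      intro hk
      have h1 := ih (by omega)
      have h2 := h.step_descent hf hL hη (t := k) (by omega)
      have h3 := h.momentum_error_le hf hL hη hβ0 hβ1 k (by omega)
      have h4 := nuclearNorm_le_add_sub (M k - matGrad f (W k)) (N k)
      have h5 : 2 * η * nuclearNorm (M k - matGrad f (W k)) ≤
          2 * η * (nuclearNorm (N k) + β * L * η / (1 - β)) :=
        mul_le_mul_of_nonneg_left (by linarith) (by positivity)
      rw [Finset.sum_range_succ, Finset.sum_range_succ]
      push_cast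
      linarith
  have h1 := key T le_rfl
  have h2 : (⨅ W, f W) ≤ f (W T) := ciInf_le hb _
  rw [gap]
  linarith

end Run

/-! ### Moments of the gradient noise when the query point is independent of the sample. -/

section Moments

variable {m n : ℕ} {Ξ Ω : Type*} [MeasurableSpace Ξ] {ma : MeasurableSpace Ω}
  [mΩ : MeasurableSpace Ω] {P : Measure Ξ} {μ : Measure Ω} [IsProbabilityMeasure μ]
  {f : Matrix (Fin m) (Fin n) ℝ → ℝ} {g : Matrix (Fin m) (Fin n) ℝ → Ξ → Matrix (Fin m) (Fin n) ℝ}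
  {σ L : ℝ}

theorem measurable_entry (i : Fin m) (j : Fin n) :
    Measurable fun A : Matrix (Fin m) (Fin n) ℝ => A i j :=
  (measurable_pi_apply j).comp (measurable_pi_apply i)

theorem measurable_frobNorm : Measurable (frobNorm : Matrix (Fin m) (Fin n) ℝ → ℝ) := by
  have h : (frobNorm : Matrix (Fin m) (Fin n) ℝ → ℝ) = fun A => √(∑ i, ∑ j, A i j ^ 2) := by
    ext A
    rw [← frobNorm_sq, Real.sqrt_sq (frobNorm_nonneg A)]
  rw [h]
  exact (Finset.measurable_fun_sum _ fun i _ => Finset.measurable_fun_sum _ fun j _ =>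
    (measurable_entry i j).pow_const 2).sqrt

theorem entry_sq_le_frobNorm_sq (A : Matrix (Fin m) (Fin n) ℝ) (i : Fin m) (j : Fin n) :
    A i j ^ 2 ≤ frobNorm A ^ 2 := by
  rw [frobNorm_sq]
  exact (Finset.single_le_sum (f := fun j => A i j ^ 2) (fun _ _ => sq_nonneg _)
    (Finset.mem_univ j)).trans (Finset.single_le_sum (f := fun i => ∑ j, A i j ^ 2)
      (fun _ _ => Finset.sum_nonneg fun _ _ => sq_nonneg _) (Finset.mem_univ i))

theorem IsStochasticGradient.measurable_noise (hg : IsStochasticGradient P f g σ)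
    (hf : IsSpectralSmooth f L) :
    Measurable fun p : Matrix (Fin m) (Fin n) ℝ × Ξ => g p.1 p.2 - matGrad f p.1 := by
  have h1 := hg.measurable
  have h2 : Measurable fun p : Matrix (Fin m) (Fin n) ℝ × Ξ => matGrad f p.1 :=
    hf.continuous_matGrad.measurable.comp measurable_fst
  exact measurable_pi_iff.2 fun i => measurable_pi_iff.2 fun j =>
    ((measurable_entry i j).comp h1).sub ((measurable_entry i j).comp h2)

/-- Replaces conditional expectation: a past-measurable `Y` and a fresh sample have a product law,
so Fubini allows `Y` to be frozen while integrating over the sample. -/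
theorem map_prodMk_eq {E : Type*} [MeasurableSpace E] (hma : ma ≤ mΩ)
    {x : Ω → Ξ} (hx : MeasurePreserving x μ P)
    (hind : Indep ma (MeasurableSpace.comap x inferInstance) μ) {Y : Ω → E}
    (hY : Measurable[ma] Y) : μ.map (fun ω => (Y ω, x ω)) = (μ.map Y).prod P := by
  have h : IndepFun Y x μ := by
    rw [IndepFun_iff_Indep]
    exact indep_of_indep_of_le_left hind hY.comap_le
  rw [(indepFun_iff_map_prod_eq_prod_map_map (hY.mono hma le_rfl).aemeasurable
    hx.measurable.aemeasurable).1 h, hx.map_eq]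

theorem IsStochasticGradient.noise_sq [IsProbabilityMeasure P] (hg : IsStochasticGradient P f g σ)
    (hf : IsSpectralSmooth f L) (hma : ma ≤ mΩ)
    {x : Ω → Ξ} (hx : MeasurePreserving x μ P)
    (hind : Indep ma (MeasurableSpace.comap x inferInstance) μ)
    {Y : Ω → Matrix (Fin m) (Fin n) ℝ} (hY : Measurable[ma] Y) :
    Integrable (fun ω => frobNorm (g (Y ω) (x ω) - matGrad f (Y ω)) ^ 2) μ ∧
      ∫ ω, frobNorm (g (Y ω) (x ω) - matGrad f (Y ω)) ^ 2 ∂μ ≤ σ ^ 2 := by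
  have hmeas : Measurable fun p : Matrix (Fin m) (Fin n) ℝ × Ξ =>
      frobNorm (g p.1 p.2 - matGrad f p.1) ^ 2 :=
    (measurable_frobNorm.comp (hg.measurable_noise hf)).pow_const 2
  have hY' : Measurable Y := hY.mono hma le_rfl
  have hYx : Measurable fun ω => (Y ω, x ω) := hY'.prodMk hx.measurable
  have : IsProbabilityMeasure (μ.map Y) := Measure.isProbabilityMeasure_map hY'.aemeasurable
  -- Tonelli needs no integrability, so one estimate yields both the finiteness and the bound.
  have hlin : ∫⁻ ω, ENNReal.ofReal (frobNorm (g (Y ω) (x ω) - matGrad f (Y ω)) ^ 2) ∂μ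
      ≤ ENNReal.ofReal (σ ^ 2) := by
    have h1 := lintegral_map (μ := μ) hmeas.ennreal_ofReal hYx
    rw [← h1, map_prodMk_eq hma hx hind hY, lintegral_prod _ hmeas.ennreal_ofReal.aemeasurable]
    have h2 : ∀ y, ∫⁻ z, ENNReal.ofReal (frobNorm (g y z - matGrad f y) ^ 2) ∂P
        ≤ ENNReal.ofReal (σ ^ 2) := by
      intro y
      rw [← ofReal_integral_eq_lintegral_ofReal (hg.integrable_sq y)
        (Filter.Eventually.of_forall fun _ => sq_nonneg _)]
      exact ENNReal.ofReal_le_ofReal (hg.variance_le y)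
    refine (lintegral_mono h2).trans ?_
    simp
  have hae := (hmeas.comp hYx).aestronglyMeasurable (μ := μ)
  have hint : Integrable (fun ω => frobNorm (g (Y ω) (x ω) - matGrad f (Y ω)) ^ 2) μ := by
    refine ⟨hae, ?_⟩
    rw [hasFiniteIntegral_iff_ofReal (Filter.Eventually.of_forall fun _ => sq_nonneg _)]
    exact hlin.trans_lt ENNReal.ofReal_lt_top
  refine ⟨hint, ?_⟩
  rw [← ofReal_integral_eq_lintegral_ofReal hint
    (Filter.Eventually.of_forall fun _ => sq_nonneg _)] at hlin
  exact (ENNReal.ofReal_le_ofReal_iff (sq_nonneg σ)).1 hlin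

/-- With `Z` and `Y` frozen, unbiasedness makes the inner integral over the sample vanish. Applied
with `Z` an entry of the past averaged noise, this kills the cross terms. -/
theorem IsStochasticGradient.integral_mul_noise [IsProbabilityMeasure P]
    (hg : IsStochasticGradient P f g σ)
    (hf : IsSpectralSmooth f L) (hma : ma ≤ mΩ)
    {x : Ω → Ξ} (hx : MeasurePreserving x μ P)
    (hind : Indep ma (MeasurableSpace.comap x inferInstance) μ)
    {Y : Ω → Matrix (Fin m) (Fin n) ℝ} (hY : Measurable[ma] Y) {Z : Ω → ℝ} (hZ : Measurable[ma] Z)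
    (i : Fin m) (j : Fin n)
    (hint : Integrable (fun ω => Z ω * (g (Y ω) (x ω) - matGrad f (Y ω)) i j) μ) :
    ∫ ω, Z ω * (g (Y ω) (x ω) - matGrad f (Y ω)) i j ∂μ = 0 := by
  have hZY : Measurable[ma] fun ω => (Z ω, Y ω) := hZ.prodMk hY
  have hZY' : Measurable fun ω => (Z ω, Y ω) := hZY.mono hma le_rfl
  have hall : Measurable fun ω => ((Z ω, Y ω), x ω) := hZY'.prodMk hx.measurable
  have : IsProbabilityMeasure (μ.map fun ω => (Z ω, Y ω)) :=
    Measure.isProbabilityMeasure_map hZY'.aemeasurable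
  set F : (ℝ × Matrix (Fin m) (Fin n) ℝ) × Ξ → ℝ :=
    fun p => p.1.1 * (g p.1.2 p.2 - matGrad f p.1.2) i j with hF
  have hFm : Measurable F := by
    refine (measurable_fst.comp measurable_fst).mul ((measurable_entry i j).comp ?_)
    exact (hg.measurable_noise hf).comp ((measurable_snd.comp measurable_fst).prodMk measurable_snd)
  have hmap := map_prodMk_eq hma hx hind hZY
  have hintF : Integrable F ((μ.map fun ω => (Z ω, Y ω)).prod P) := by
    rw [← hmap, integrable_map_measure hFm.aestronglyMeasurable hall.aemeasurable]
    exact hint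
  have h1 : ∫ ω, Z ω * (g (Y ω) (x ω) - matGrad f (Y ω)) i j ∂μ =
      ∫ p, F p ∂((μ.map fun ω => (Z ω, Y ω)).prod P) := by
    rw [← hmap, integral_map hall.aemeasurable hFm.aestronglyMeasurable]
  rw [h1, integral_prod _ hintF]
  have h2 : ∀ p : ℝ × Matrix (Fin m) (Fin n) ℝ, ∫ z, F (p, z) ∂P = 0 := by
    intro p
    simp only [hF, Matrix.sub_apply]
    rw [integral_const_mul, integral_sub (hg.integrable _ _ _) (integrable_const _),
      hg.unbiased]
    simp
  simp [h2]

/-- Integrates 2cX ≤ X² + c². -/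
theorem integral_le_of_integral_sq_le {X : Ω → ℝ} (hX : Integrable X μ)
    (hX2 : Integrable (fun ω => X ω ^ 2) μ) {c : ℝ} (hc : 0 < c) (h : ∫ ω, X ω ^ 2 ∂μ ≤ c ^ 2) :
    ∫ ω, X ω ∂μ ≤ c := by
  have h1 : ∫ ω, 2 * c * X ω ∂μ ≤ ∫ ω, (X ω ^ 2 + c ^ 2) ∂μ :=
    integral_mono (hX.const_mul _) (hX2.add (integrable_const _))
      fun ω => by simp only; nlinarith [sq_nonneg (X ω - c)]
  rw [integral_const_mul, integral_add hX2 (integrable_const _)] at h1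
  simp only [integral_const, probReal_univ, one_smul] at h1
  nlinarith

end Moments

/-! ### Adaptedness of the stochastic run and growth of the averaged noise. -/

section Filtration

variable {m n T : ℕ} {Ξ Ω : Type*} [mΞ : MeasurableSpace Ξ] [mΩ : MeasurableSpace Ω]
  {P : Measure Ξ} {μ : Measure Ω} {f : Matrix (Fin m) (Fin n) ℝ → ℝ}
  {g : Matrix (Fin m) (Fin n) ℝ → Ξ → Matrix (Fin m) (Fin n) ℝ}
  {σ L η β : ℝ} {W₀ : Matrix (Fin m) (Fin n) ℝ} {ξ : ℕ → Fin 1 → Ω → Ξ}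
  {M W : ℕ → Ω → Matrix (Fin m) (Fin n) ℝ}

/-- The σ-algebra generated by the samples drawn before time `t`. -/
abbrev past (T : ℕ) (ξ : ℕ → Fin 1 → Ω → Ξ) (t : ℕ) : MeasurableSpace Ω :=
  ⨆ p ∈ {p : Fin T × Fin 1 | (p.1 : ℕ) < t}, MeasurableSpace.comap (ξ p.1 p.2) mΞ

omit mΩ in
theorem past_mono {s t : ℕ} (h : s ≤ t) : past T ξ s ≤ past T ξ t :=
  biSup_mono fun _ hp => lt_of_lt_of_le hp h

omit mΩ in
theorem measurable_past_succ {t : ℕ} (ht : t < T) : Measurable[past T ξ (t + 1)] (ξ t 0) := by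
  rw [measurable_iff_comap_le]
  exact le_biSup (fun p : Fin T × Fin 1 => MeasurableSpace.comap (ξ p.1 p.2) mΞ)
    (i := (⟨t, ht⟩, 0)) (Nat.lt_succ_self t)

theorem IsStochasticMuonRun.past_le (h : IsStochasticMuonRun P μ g T 1 η β W₀ ξ M W) (t : ℕ) :
    past T ξ t ≤ mΩ :=
  iSup₂_le fun p _ => (h.sample_law p.1 p.1.2 p.2).measurable.comap_le

theorem IsStochasticMuonRun.indep_past (h : IsStochasticMuonRun P μ g T 1 η β W₀ ξ M W)
    {t : ℕ} (ht : t < T) :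
    Indep (past T ξ t) (MeasurableSpace.comap (ξ t 0) mΞ) μ := by
  have hdisj : Disjoint {p : Fin T × Fin 1 | (p.1 : ℕ) < t} {(⟨t, ht⟩, 0)} := by
    simp
  have := indep_iSup_of_disjoint
    (fun p : Fin T × Fin 1 => (h.sample_law p.1 p.1.2 p.2).measurable.comap_le) h.sample_indep hdisj
  simpa [past] using this

/-- The noise of the stochastic gradient in iteration `t`. -/
noncomputable def noise (f : Matrix (Fin m) (Fin n) ℝ → ℝ)
    (g : Matrix (Fin m) (Fin n) ℝ → Ξ → Matrix (Fin m) (Fin n) ℝ)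
    (ξ : ℕ → Fin 1 → Ω → Ξ) (W : ℕ → Ω → Matrix (Fin m) (Fin n) ℝ) (t : ℕ) (ω : Ω) :
    Matrix (Fin m) (Fin n) ℝ :=
  g (W t ω) (ξ t 0 ω) - matGrad f (W t ω)

theorem IsStochasticMuonRun.run_one (h : IsStochasticMuonRun P μ g T 1 η β W₀ ξ M W) (ω : Ω) :
    IsMuonRun T η β W₀ (fun t => g (W t ω) (ξ t 0 ω)) (fun t => M t ω) (fun t => W t ω) := by
  simpa using h.run ω

/-- Iterate `t` uses only samples before `t`, whereas the momentum and averaged noise at `t` also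
use sample `t`; hence the shift by one. The three claims need a joint induction because the next
iterate is built from the current momentum. -/
theorem IsStochasticMuonRun.measurable_past (h : IsStochasticMuonRun P μ g T 1 η β W₀ ξ M W)
    (hg : IsStochasticGradient P f g σ) (hf : IsSpectralSmooth f L) :
    ∀ t < T, Measurable[past T ξ t] (W t) ∧ Measurable[past T ξ (t + 1)] (M t) ∧
      Measurable[past T ξ (t + 1)] (fun ω => noiseMomentum β (fun t => noise f g ξ W t ω) t) := by
  have smul_meas : ∀ (ma : MeasurableSpace Ω) (c : ℝ) (A : Ω → Matrix (Fin m) (Fin n) ℝ),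
      Measurable[ma] A → Measurable[ma] (fun ω => c • A ω) := fun ma c A hA =>
    (continuous_const_smul c).measurable.comp hA
  have add_meas : ∀ (ma : MeasurableSpace Ω) (A B : Ω → Matrix (Fin m) (Fin n) ℝ),
      Measurable[ma] A → Measurable[ma] B → Measurable[ma] (fun ω => A ω + B ω) :=
    fun ma A B hA hB => measurable_pi_iff.2 fun i => measurable_pi_iff.2 fun j =>
      ((measurable_entry i j).comp hA).add ((measurable_entry i j).comp hB)
  have hG : ∀ t < T, Measurable[past T ξ t] (W t) →
      Measurable[past T ξ (t + 1)] (fun ω => g (W t ω) (ξ t 0 ω)) := fun t ht hW =>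
    hg.measurable.comp ((hW.mono (past_mono t.le_succ) le_rfl).prodMk (measurable_past_succ ht))
  have hZ : ∀ t < T, Measurable[past T ξ t] (W t) →
      Measurable[past T ξ (t + 1)] (fun ω => noise f g ξ W t ω) := fun t ht hW =>
    (hg.measurable_noise hf).comp
      ((hW.mono (past_mono t.le_succ) le_rfl).prodMk (measurable_past_succ ht))
  intro t
  induction t with
  | zero =>
    intro ht
    have hW : Measurable[past T ξ 0] (W 0) := by
      have : W 0 = fun _ => W₀ := funext fun ω => (h.run_one ω).init
      rw [this]; exact measurable_const
    refine ⟨hW, ?_, hZ 0 ht hW⟩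
    have : M 0 = fun ω => g (W 0 ω) (ξ 0 0 ω) := funext fun ω => (h.run_one ω).momentum_zero
    rw [this]; exact hG 0 ht hW
  | succ t ih =>
    intro ht
    obtain ⟨hW, hM, hN⟩ := ih (by omega)
    have hW' : Measurable[past T ξ (t + 1)] (W (t + 1)) := by
      choose k U s V hsvd hstep using fun ω => (h.run_one ω).step t (by omega)
      have hO := @measurable_of_isCompactSVD _ _ Ω (past T ξ (t + 1)) (M t)
        (fun ω => U ω * (V ω)ᵀ) hM fun ω => ⟨k ω, U ω, s ω, V ω, hsvd ω, rfl⟩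
      have : W (t + 1) = fun ω => W t ω + (-η) • (U ω * (V ω)ᵀ) := by
        funext ω; rw [hstep ω, neg_smul, sub_eq_add_neg]
      rw [this]
      exact add_meas _ _ _ (hW.mono (past_mono t.le_succ) le_rfl) (smul_meas _ _ _ hO)
    have hle : past T ξ (t + 1) ≤ past T ξ (t + 1 + 1) := past_mono (Nat.le_succ _)
    refine ⟨hW', ?_, ?_⟩
    · have : M (t + 1) = fun ω => β • M t ω + (1 - β) • g (W (t + 1) ω) (ξ (t + 1) 0 ω) :=
        funext fun ω => (h.run_one ω).momentum_succ t ht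
      rw [this]
      exact add_meas _ _ _ (smul_meas _ _ _ (hM.mono hle le_rfl)) (smul_meas _ _ _ (hG _ ht hW'))
    · simp only [noiseMomentum]
      exact add_meas _ _ _ (smul_meas _ _ _ (hN.mono hle le_rfl)) (smul_meas _ _ _ (hZ _ ht hW'))

/-- Orthogonality gives the recursion v_{t+1} ≤ β²v_t + (1-β)²σ² from v_0 ≤ σ². The stated bound is
preserved because β²(1-β) + (1-β)² ≤ 1-β. The transient β^(2t) reflects that the first gradient
enters the momentum with weight 1 rather than 1-β. -/
theorem IsStochasticMuonRun.noiseMomentum_sq [IsProbabilityMeasure μ] [IsProbabilityMeasure P]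
    (h : IsStochasticMuonRun P μ g T 1 η β W₀ ξ M W)
    (hg : IsStochasticGradient P f g σ) (hf : IsSpectralSmooth f L) (hβ0 : 0 ≤ β) (hβ1 : β < 1) :
    ∀ t < T,
      Integrable (fun ω => frobNorm (noiseMomentum β (fun t => noise f g ξ W t ω) t) ^ 2) μ ∧
      ∫ ω, frobNorm (noiseMomentum β (fun t => noise f g ξ W t ω) t) ^ 2 ∂μ ≤
        β ^ (2 * t) * σ ^ 2 + (1 - β) * σ ^ 2 := by
  have hZ : ∀ t < T, Integrable (fun ω => frobNorm (noise f g ξ W t ω) ^ 2) μ ∧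
      ∫ ω, frobNorm (noise f g ξ W t ω) ^ 2 ∂μ ≤ σ ^ 2 := fun t ht =>
    hg.noise_sq hf (h.past_le t) (h.sample_law t ht 0) (h.indep_past ht)
      (h.measurable_past hg hf t ht).1
  intro t
  induction t with
  | zero =>
    intro ht
    refine ⟨(hZ 0 ht).1, (hZ 0 ht).2.trans ?_⟩
    have : 0 ≤ (1 - β) * σ ^ 2 := mul_nonneg (by linarith) (sq_nonneg σ)
    simpa using this
  | succ t ih =>
    intro ht
    obtain ⟨hNi, hN⟩ := ih (by omega)
    obtain ⟨hZi, hZ1⟩ := hZ (t + 1) ht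
    obtain ⟨hW, -, -⟩ := h.measurable_past hg hf (t + 1) ht
    obtain ⟨-, -, hNm⟩ := h.measurable_past hg hf t (by omega)
    set N : Ω → Matrix (Fin m) (Fin n) ℝ :=
      fun ω => noiseMomentum β (fun t => noise f g ξ W t ω) t
    set Z : Ω → Matrix (Fin m) (Fin n) ℝ := noise f g ξ W (t + 1) with hZdef
    have hNm' : Measurable N := hNm.mono (h.past_le _) le_rfl
    have hZm : Measurable Z := (hg.measurable_noise hf).comp
      ((hW.mono (h.past_le _) le_rfl).prodMk (h.sample_law _ ht 0).measurable)
    have memLp : ∀ A : Ω → Matrix (Fin m) (Fin n) ℝ, Measurable A →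
        Integrable (fun ω => frobNorm (A ω) ^ 2) μ → ∀ i j, MemLp (fun ω => A ω i j) 2 μ := by
      intro A hA hint i j
      have hm : AEStronglyMeasurable (fun ω => A ω i j) μ :=
        ((measurable_entry i j).comp hA).aestronglyMeasurable
      rw [memLp_two_iff_integrable_sq hm]
      refine hint.mono' (hm.pow 2) (Filter.Eventually.of_forall fun ω => ?_)
      rw [Real.norm_eq_abs, abs_of_nonneg (sq_nonneg _)]
      exact entry_sq_le_frobNorm_sq _ i j
    have hNij := memLp N hNm' hNi
    have hZij := memLp Z hZm hZi
    have hcross : ∀ i j, Integrable (fun ω => N ω i j * Z ω i j) μ := fun i j =>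
      (hNij i j).integrable_mul (hZij i j)
    have hzero : ∀ i j, ∫ ω, N ω i j * Z ω i j ∂μ = 0 := fun i j =>
      hg.integral_mul_noise hf (h.past_le (t + 1)) (h.sample_law _ ht 0) (h.indep_past ht) hW
        ((measurable_entry i j).comp hNm) i j (hcross i j)
    have hexp : ∀ ω, frobNorm (noiseMomentum β (fun t => noise f g ξ W t ω) (t + 1)) ^ 2 =
        β ^ 2 * frobNorm (N ω) ^ 2 + (1 - β) ^ 2 * frobNorm (Z ω) ^ 2 +
          2 * β * (1 - β) * ∑ i, ∑ j, N ω i j * Z ω i j := by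
      intro ω
      simp only [frobNorm_sq, Finset.mul_sum, ← Finset.sum_add_distrib]
      refine Finset.sum_congr rfl fun i _ => Finset.sum_congr rfl fun j _ => ?_
      simp only [noiseMomentum, Matrix.add_apply, Matrix.smul_apply, smul_eq_mul]
      ring
    have hci : Integrable (fun ω => ∑ i, ∑ j, N ω i j * Z ω i j) μ :=
      integrable_finsetSum _ fun i _ => integrable_finsetSum _ fun j _ => hcross i j
    have hc0 : ∫ ω, ∑ i, ∑ j, N ω i j * Z ω i j ∂μ = 0 := by
      rw [integral_finsetSum _ fun i _ => integrable_finsetSum _ fun j _ => hcross i j]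
      refine Finset.sum_eq_zero fun i _ => ?_
      rw [integral_finsetSum _ fun j _ => hcross i j]
      exact Finset.sum_eq_zero fun j _ => hzero i j
    simp_rw [hexp]
    have hi1 : Integrable
        (fun ω => β ^ 2 * frobNorm (N ω) ^ 2 + (1 - β) ^ 2 * frobNorm (Z ω) ^ 2) μ :=
      (hNi.const_mul (β ^ 2)).add (hZi.const_mul ((1 - β) ^ 2))
    refine ⟨hi1.add (hci.const_mul _), ?_⟩
    rw [integral_add hi1 (hci.const_mul _),
      integral_add (hNi.const_mul (β ^ 2)) (hZi.const_mul ((1 - β) ^ 2)), integral_const_mul,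
      integral_const_mul, integral_const_mul, hc0, mul_zero, add_zero]
    have h1 := mul_le_mul_of_nonneg_left hN (sq_nonneg β)
    have h2 := mul_le_mul_of_nonneg_left hZ1 (sq_nonneg (1 - β))
    have h3 : 0 ≤ β * (1 - β) * (1 - β) * σ ^ 2 := by
      have : 0 ≤ 1 - β := by linarith
      positivity
    have h4 : β ^ (2 * (t + 1)) = β ^ 2 * β ^ (2 * t) := by rw [mul_add, pow_add]; ring
    rw [h4]
    nlinarith

theorem IsStochasticMuonRun.integral_noiseMomentum_le [IsProbabilityMeasure μ]
    [IsProbabilityMeasure P]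
    (h : IsStochasticMuonRun P μ g T 1 η β W₀ ξ M W)
    (hg : IsStochasticGradient P f g σ) (hf : IsSpectralSmooth f L) (hσ : 0 < σ)
    (hβ0 : 0 ≤ β) (hβ1 : β < 1) {t : ℕ} (ht : t < T) :
    Integrable (fun ω => frobNorm (noiseMomentum β (fun t => noise f g ξ W t ω) t)) μ ∧
      ∫ ω, frobNorm (noiseMomentum β (fun t => noise f g ξ W t ω) t) ∂μ ≤
        β ^ t * σ + √(1 - β) * σ := by
  obtain ⟨hi, hle⟩ := h.noiseMomentum_sq hg hf hβ0 hβ1 t ht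
  have hm := measurable_frobNorm.comp
    ((h.measurable_past hg hf t ht).2.2.mono (h.past_le _) le_rfl)
  have hint : Integrable (fun ω => frobNorm (noiseMomentum β (fun t => noise f g ξ W t ω) t)) μ :=
    ((memLp_two_iff_integrable_sq hm.aestronglyMeasurable).2 hi).integrable one_le_two
  have hs : 0 < √(1 - β) := Real.sqrt_pos.2 (by linarith)
  have hss : √(1 - β) ^ 2 = 1 - β := Real.sq_sqrt (by linarith)
  refine ⟨hint, integral_le_of_integral_sq_le hint hi (by positivity) (hle.trans ?_)⟩
  have h1 : 0 ≤ 2 * (β ^ t * √(1 - β)) * σ ^ 2 := by positivity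
  have h2 : (β ^ t * σ + √(1 - β) * σ) ^ 2 =
      (β ^ t) ^ 2 * σ ^ 2 + √(1 - β) ^ 2 * σ ^ 2 + 2 * (β ^ t * √(1 - β)) * σ ^ 2 := by ring
  rw [hss] at h2
  rw [pow_mul', h2]
  linarith

/-- Each step has spectral length at most η, so the gradient at time `t` is bounded by a constant
independent of the sample point. -/
theorem IsStochasticMuonRun.hasFiniteExpectedGradients [IsProbabilityMeasure μ]
    (h : IsStochasticMuonRun P μ g T 1 η β W₀ ξ M W)
    (hg : IsStochasticGradient P f g σ) (hf : IsSpectralSmooth f L) (hL : 0 ≤ L) (hη : 0 ≤ η) :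
    HasFiniteExpectedGradients μ f T W := by
  intro t ht
  have hm : Measurable fun ω => nuclearNorm (matGrad f (W t ω)) :=
    hf.continuous_nuclearNorm_matGrad.measurable.comp
      ((h.measurable_past hg hf t ht).1.mono (h.past_le _) le_rfl)
  refine (integrable_const (nuclearNorm (matGrad f W₀) + L * (t * η))).mono'
    hm.aestronglyMeasurable (Filter.Eventually.of_forall fun ω => ?_)
  rw [Real.norm_eq_abs, abs_of_nonneg (nuclearNorm_nonneg _)]
  have h1 := nuclearNorm_le_add_sub (matGrad f (W t ω)) (matGrad f W₀)
  have h2 := hf.gradient_le (W t ω) W₀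
  have h3 := mul_le_mul_of_nonneg_left ((h.run_one ω).opNorm_sub_init_le hη t ht.le) hL
  linarith

/-- The convergence estimate for Muon with arbitrary parameters. -/
theorem IsStochasticMuonRun.mul_sum_integral_le [IsProbabilityMeasure μ] [IsProbabilityMeasure P]
    (h : IsStochasticMuonRun P μ g T 1 η β W₀ ξ M W)
    (hg : IsStochasticGradient P f g σ) (hf : IsSpectralSmooth f L)
    (hb : BddBelow (Set.range f)) (hL : 0 ≤ L) (hσ : 0 < σ) (hη : 0 ≤ η) (hβ0 : 0 ≤ β)
    (hβ1 : β < 1) :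
    η * ∑ t ∈ Finset.range T, ∫ ω, nuclearNorm (matGrad f (W t ω)) ∂μ ≤
      gap f W₀ + 2 * η * (√((min m n : ℕ) : ℝ) * (σ / (1 - β) + T * (√(1 - β) * σ)))
      + T * (2 * η * (β * L * η / (1 - β)) + L * η ^ 2) := by
  set r : ℝ := √((min m n : ℕ) : ℝ)
  set N : ℕ → Ω → Matrix (Fin m) (Fin n) ℝ :=
    fun t ω => noiseMomentum β (fun t => noise f g ξ W t ω) t with hN
  set K : ℝ := T * (2 * η * (β * L * η / (1 - β)) + L * η ^ 2)
  have hfin := h.hasFiniteExpectedGradients hg hf hL hη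
  have hNint := fun t (ht : t ∈ Finset.range T) =>
    h.integral_noiseMomentum_le hg hf hσ hβ0 hβ1 (Finset.mem_range.1 ht)
  have hpt : ∀ ω, η * ∑ t ∈ Finset.range T, nuclearNorm (matGrad f (W t ω)) ≤
      gap f W₀ + 2 * η * ∑ t ∈ Finset.range T, r * frobNorm (N t ω) + K := by
    intro ω
    refine ((h.run_one ω).sum_nuclearNorm_le hf hL hη hβ0 hβ1 hb).trans ?_
    gcongr with t ht
    exact nuclearNorm_le_sqrt_mul_frobNorm _
  have hsumint : Integrable (fun ω => ∑ t ∈ Finset.range T, r * frobNorm (N t ω)) μ :=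
    integrable_finsetSum _ fun t ht => (hNint t ht).1.const_mul r
  have hsumint' : Integrable (fun ω => gap f W₀ + 2 * η * ∑ t ∈ Finset.range T,
      r * frobNorm (N t ω)) μ := (integrable_const (gap f W₀)).add (hsumint.const_mul (2 * η))
  have hmono := integral_mono
    ((integrable_finsetSum _ fun t ht => hfin t (Finset.mem_range.1 ht)).const_mul η)
    (hsumint'.add (integrable_const K)) hpt
  rw [integral_const_mul, integral_finsetSum _ fun t ht => hfin t (Finset.mem_range.1 ht)] at hmono
  refine hmono.trans ?_
  have e : ∫ ω, (gap f W₀ + 2 * η * ∑ t ∈ Finset.range T, r * frobNorm (N t ω) + K) ∂μ =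
      gap f W₀ + 2 * η * ∑ t ∈ Finset.range T, r * ∫ ω, frobNorm (N t ω) ∂μ + K := by
    rw [integral_add hsumint' (integrable_const K), integral_add (integrable_const _) (hsumint.const_mul (2 * η)),
      integral_const_mul, integral_finsetSum _ fun t ht => (hNint t ht).1.const_mul r]
    simp only [integral_const, probReal_univ, one_smul, integral_const_mul]
    rfl
  refine e.le.trans ?_
  -- The transients of the initial noise sum to at most σ/(1-β) over the whole run; this becomes the
  -- third term of the stochastic rate.
  have hgeom : ∑ t ∈ Finset.range T, β ^ t ≤ 1 / (1 - β) := by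
    have h1 : 0 < 1 - β := by linarith
    rw [le_div_iff₀ h1, mul_comm, mul_neg_geom_sum]
    have := pow_nonneg hβ0 T
    linarith
  have hs : ∑ t ∈ Finset.range T, r * ∫ ω, frobNorm (N t ω) ∂μ ≤
      r * (σ / (1 - β) + T * (√(1 - β) * σ)) := by
    rw [← Finset.mul_sum]
    refine mul_le_mul_of_nonneg_left ?_ (Real.sqrt_nonneg _)
    refine (Finset.sum_le_sum fun t ht => (hNint t ht).2).trans ?_
    rw [Finset.sum_add_distrib, ← Finset.sum_mul, Finset.sum_const, Finset.card_range,
      nsmul_eq_mul]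
    have := mul_le_mul_of_nonneg_right hgeom hσ.le
    have e2 : 1 / (1 - β) * σ = σ / (1 - β) := by ring
    linarith
  have := mul_le_mul_of_nonneg_left hs (by positivity : 0 ≤ 2 * η)
  linarith

end Filtration

/-! ### Choice of parameters, rates and iteration counts. -/

section Rates

variable {m n T : ℕ} {f : Matrix (Fin m) (Fin n) ℝ → ℝ} {L σ η β ε : ℝ}
  {W₀ : Matrix (Fin m) (Fin n) ℝ}

theorem exists_le_of_average_le {a : ℕ → ℝ} (hT : 1 ≤ T)
    (h : 1 / (T : ℝ) * ∑ t ∈ Finset.range T, a t ≤ ε) : ∃ t < T, a t ≤ ε := by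
  have hT' : (0 : ℝ) < T := by exact_mod_cast hT
  have h1 : ∑ t ∈ Finset.range T, a t ≤ ∑ t ∈ Finset.range T, ε := by
    rw [Finset.sum_const, Finset.card_range, nsmul_eq_mul]
    rw [one_div, inv_mul_le_iff₀ hT'] at h
    exact h
  obtain ⟨t, ht, hle⟩ := Finset.exists_le_of_sum_le ⟨0, Finset.mem_range.2 hT⟩ h1
  exact ⟨t, Finset.mem_range.1 ht, hle⟩

/-- In the application ρ = √r, a = √(LΔ), x = √T, q = 1-β. If the quotient is the minimum, `A` and
ρσ√q both equal the fourth-root term `Q`, and the transient is exactly the third term. If q = 1,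
then ρσ ≤ a/x and everything is controlled by a/x. The factor 8 is 4 + 2 + 2. -/
theorem stochastic_terms_le {ρ a x q A Q : ℝ} (hρ : 0 ≤ ρ) (hσ : 0 < σ) (ha : 0 < a)
    (hx : 1 ≤ x) (hq : 0 < q) (hqe : q = min (a / (σ * (ρ * x))) 1) (hA : 0 ≤ A)
    (hA2 : A ^ 2 = a ^ 2 / (x ^ 2 * q)) (hQ : 0 ≤ Q)
    (hQ4 : Q ^ 4 = ρ ^ 2 * a ^ 2 * σ ^ 2 / x ^ 2) :
    4 * A + 2 * (ρ * σ / (x ^ 2 * q)) + 2 * (ρ * σ * √q) ≤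
      8 * (Q + a / x + ρ ^ 2 * σ ^ 2 / (a * x)) := by
  have hx0 : 0 < x := by linarith
  have h2 : 0 ≤ a / x := by positivity
  have h3 : 0 ≤ ρ ^ 2 * σ ^ 2 / (a * x) := by positivity
  -- For ρ = 0 the quotient is a division by zero, hence 0, and q = 0 contradicts `hq`.
  have hρ' : 0 < ρ := by
    rcases hρ.eq_or_lt with h | h
    · rw [← h] at hqe
      simp at hqe
      linarith
    · exact h
  rcases le_total (a / (σ * (ρ * x))) 1 with hle | hle
  · rw [min_eq_left hle] at hqe
    have hQ2 : Q ^ 2 = ρ * a * σ / x := by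
      refine (pow_left_inj₀ (sq_nonneg Q) (by positivity) two_ne_zero).1 ?_
      rw [← pow_mul, hQ4]
      field_simp
    have hAQ : A = Q := by
      refine (pow_left_inj₀ hA hQ two_ne_zero).1 ?_
      rw [hA2, hQ2, hqe]
      field_simp
    have hSQ : ρ * σ * √q = Q := by
      refine (pow_left_inj₀ (by positivity) hQ two_ne_zero).1 ?_
      rw [mul_pow, Real.sq_sqrt hq.le, hQ2, hqe]
      field_simp
    have hthird : ρ * σ / (x ^ 2 * q) = ρ ^ 2 * σ ^ 2 / (a * x) := by
      rw [hqe]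
      field_simp
    rw [hAQ, hSQ, hthird]
    linarith
  · rw [min_eq_right hle] at hqe
    rw [one_le_div (by positivity)] at hle
    have hAx : A = a / x := by
      refine (pow_left_inj₀ hA h2 two_ne_zero).1 ?_
      rw [hA2, hqe]
      field_simp
    have h4 : ρ * σ ≤ a / x := by
      rw [le_div_iff₀ hx0]
      linarith
    have h5 : ρ * σ / (x ^ 2 * q) ≤ ρ * σ := by
      refine div_le_self (by positivity) ?_
      rw [hqe, mul_one]
      exact one_le_pow₀ hx
    have h6 : √q = 1 := by rw [hqe, Real.sqrt_one]
    rw [hAx, h6]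
    linarith

theorem stochastic_rate (hL : 0 < L) (hσ : 0 < σ) (hf : IsSpectralSmooth f L)
    (hb : BddBelow (Set.range f)) {Ξ : Type*} [MeasurableSpace Ξ] {P : Measure Ξ}
    [IsProbabilityMeasure P] {g : Matrix (Fin m) (Fin n) ℝ → Ξ → Matrix (Fin m) (Fin n) ℝ}
    (hg : IsStochasticGradient P f g σ) (hT : 1 ≤ T) (hβ0 : 0 ≤ β) (hβ1 : β < 1)
    (hβ : 1 - β = min (√(L * gap f W₀) / (σ * √(((min m n : ℕ) : ℝ) * T))) 1)
    (hη : η = √((1 - β) * gap f W₀ / (T * L))) {Ω : Type*} [MeasurableSpace Ω] {μ : Measure Ω}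
    [IsProbabilityMeasure μ] {ξ : ℕ → Fin 1 → Ω → Ξ} {M W : ℕ → Ω → Matrix (Fin m) (Fin n) ℝ}
    (h : IsStochasticMuonRun P μ g T 1 η β W₀ ξ M W) :
    HasFiniteExpectedGradients μ f T W ∧
      avgExpectedGradient μ f T W ≤
        8 * ((((min m n : ℕ) : ℝ) * L * gap f W₀ * σ ^ 2 / T) ^ ((1 : ℝ) / 4)
          + √(L * gap f W₀ / T)
          + ((min m n : ℕ) : ℝ) * σ ^ 2 / √(L * gap f W₀ * T)) := by
  have hη0 : 0 ≤ η := by rw [hη]; exact Real.sqrt_nonneg _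
  refine ⟨h.hasFiniteExpectedGradients hg hf hL.le hη0, ?_⟩
  have hmain := h.mul_sum_integral_le hg hf hb hL.le hσ hη0 hβ0 hβ1
  rw [avgExpectedGradient]
  set S := ∑ t ∈ Finset.range T, ∫ ω, nuclearNorm (matGrad f (W t ω)) ∂μ
  set Δ := gap f W₀
  set r : ℝ := ((min m n : ℕ) : ℝ)
  have hr : 0 ≤ r := Nat.cast_nonneg _
  have hT1 : (1 : ℝ) ≤ T := by exact_mod_cast hT
  have hT0 : (0 : ℝ) < T := by linarith
  set q := 1 - β with hq
  have hq0 : 0 < q := sub_pos.2 hβ1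
  -- A zero gap would make the minimum in `hβ` equal to 0, that is β = 1.
  have hΔ : 0 < Δ := by
    refine lt_of_le_of_ne (gap_nonneg hb W₀) fun (h0 : 0 = Δ) => ?_
    rw [← h0] at hβ
    simp at hβ
    linarith
  set ρ := √r
  set x := √(T : ℝ)
  set a := √(L * Δ)
  have hx2 : x ^ 2 = T := Real.sq_sqrt hT0.le
  have ha2 : a ^ 2 = L * Δ := Real.sq_sqrt (by positivity)
  have hρ2 : ρ ^ 2 = r := Real.sq_sqrt hr
  have ha : 0 < a := Real.sqrt_pos.2 (by positivity)
  have hx : 1 ≤ x := Real.one_le_sqrt.2 hT1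
  have hx0 : 0 < x := by linarith
  set A := √(L * Δ / (T * q)) with hAdef
  have hA : 0 ≤ A := Real.sqrt_nonneg _
  have hA2 : A ^ 2 = L * Δ / (T * q) := Real.sq_sqrt (by positivity)
  have hη2 : η ^ 2 = q * Δ / (T * L) := by rw [hη]; exact Real.sq_sqrt (by positivity)
  have hηpos : 0 < η := by rw [hη]; exact Real.sqrt_pos.2 (by positivity)
  -- This identity and the next express Lη and Δ through `A`, so that every term of `hmain` carries
  -- a factor η, which then cancels.
  have hLη : L * η = q * A := by
    refine (pow_left_inj₀ (by positivity) (by positivity) two_ne_zero).1 ?_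
    rw [mul_pow, mul_pow, hη2, hA2]
    field_simp
  have hΔA : Δ = η * (T * A) := by
    refine (pow_left_inj₀ hΔ.le (by positivity) two_ne_zero).1 ?_
    rw [mul_pow, mul_pow, hη2, hA2]
    field_simp
  have e1 : β * L * η / q = β * A := by
    rw [mul_assoc, hLη]
    field_simp
  have e2 : L * η ^ 2 = η * (q * A) := by rw [← hLη]; ring
  have hS : S ≤ T * A + 2 * (ρ * (σ / q + T * (√q * σ))) + T * (2 * (β * A) + q * A) := by
    refine le_of_mul_le_mul_left (hmain.trans (le_of_eq ?_)) hηpos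
    rw [e1, e2]
    conv_lhs => rw [hΔA]
    ring
  have hS2 : 1 / (T : ℝ) * S ≤ 4 * A + 2 * (ρ * σ / (x ^ 2 * q)) + 2 * (ρ * σ * √q) := by
    rw [one_div, inv_mul_le_iff₀ hT0, hx2]
    have e3 : (T : ℝ) * (4 * A + 2 * (ρ * σ / (T * q)) + 2 * (ρ * σ * √q)) =
        4 * (T * A) + 2 * (ρ * (σ / q + T * (√q * σ))) := by
      field_simp
      ring
    have h1 : (2 * β + q) * (T * A) ≤ 3 * (T * A) :=
      mul_le_mul_of_nonneg_right (by linarith) (by positivity)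
    rw [e3]
    linarith
  have e4 : √(L * Δ / T) = a / x := Real.sqrt_div (by positivity) _
  have e5 : √(L * Δ * T) = a * x := Real.sqrt_mul (by positivity) _
  rw [e4, e5, ← hρ2]
  refine hS2.trans (stochastic_terms_le (Real.sqrt_nonneg _) hσ ha hx hq0 ?_ hA ?_ ?_ ?_)
  · rw [hβ, Real.sqrt_mul hr]
  · rw [hA2, ha2, hx2]
  · positivity
  · rw [← Real.rpow_natCast, ← Real.rpow_mul (by positivity), ha2, hx2, mul_assoc (ρ ^ 2) L Δ]
    norm_num

/-- With b = σ√r and D = LΔ, the hypotheses read ε ≤ b and εb ≤ D. The lower bound on `T` makes the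
fourth-root term at most ε/24, and these two inequalities bring the other two terms below ε/24 as
well; 24 = 8 · 3. The first conclusion lets the rounding up of the iteration count be absorbed into
the constant. -/
theorem stochastic_rate_le (hσ : 0 < σ) (hε : 0 < ε) {r Δ : ℝ} (hr : 0 ≤ r)
    (h1 : ε ≤ σ * √r) (h2 : ε ≤ L * Δ / (σ * √r)) :
    1 ≤ r * L * σ ^ 2 * Δ / ε ^ 4 ∧ ∀ T : ℝ, 24 ^ 4 * (r * L * σ ^ 2 * Δ / ε ^ 4) ≤ T →
      8 * ((r * L * Δ * σ ^ 2 / T) ^ ((1 : ℝ) / 4) + √(L * Δ / T) + r * σ ^ 2 / √(L * Δ * T))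
        ≤ ε := by
  set ρ := √r
  have hρ2 : ρ ^ 2 = r := Real.sq_sqrt hr
  have hb : 0 < σ * ρ := hε.trans_le h1
  have hρ : 0 < ρ := pos_of_mul_pos_right hb hσ.le
  rw [le_div_iff₀ hb] at h2
  have hLΔ : 0 < L * Δ := (mul_pos hε hb).trans_le h2
  set b := σ * ρ with hbdef
  set D := L * Δ with hD
  have hrb : r * σ ^ 2 = b ^ 2 := by rw [hbdef, mul_pow, hρ2]; ring
  have hX : r * L * σ ^ 2 * Δ / ε ^ 4 = b ^ 2 * D / ε ^ 4 := by rw [← hrb, hD]; ring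
  have hQ : r * L * Δ * σ ^ 2 = b ^ 2 * D := by rw [← hrb, hD]; ring
  rw [hX, hrb, hQ]
  have hε2 : ε ^ 2 ≤ b ^ 2 := pow_le_pow_left₀ hε.le h1 2
  have hεb : ε ^ 2 * b ^ 2 ≤ D ^ 2 := by
    rw [← mul_pow]; exact pow_le_pow_left₀ (by positivity) h2 2
  refine ⟨?_, fun T hT => ?_⟩
  · rw [one_le_div (by positivity)]
    have : ε ^ 2 ≤ D := by nlinarith
    calc ε ^ 4 = ε ^ 2 * ε ^ 2 := by ring
      _ ≤ b ^ 2 * D := mul_le_mul hε2 this (by positivity) (by positivity)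
  have hT0 : 0 < T := lt_of_lt_of_le (by positivity) hT
  rw [← mul_div_assoc, div_le_iff₀ (by positivity)] at hT
  have t1 : (b ^ 2 * D / T) ^ ((1 : ℝ) / 4) ≤ ε / 24 := by
    have : b ^ 2 * D / T ≤ (ε / 24) ^ 4 := by
      rw [div_le_iff₀ hT0]
      nlinarith
    refine (Real.rpow_le_rpow (by positivity) this (by norm_num)).trans (le_of_eq ?_)
    rw [← Real.rpow_natCast, ← Real.rpow_mul (by positivity)]
    norm_num
  have t2 : √(D / T) ≤ ε / 24 := by
    rw [Real.sqrt_le_left (by positivity), div_le_iff₀ hT0]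
    have : ε ^ 2 * (24 ^ 4 * D) ≤ ε ^ 2 * (T * ε ^ 2) := by
      have := mul_le_mul_of_nonneg_right hε2 (by positivity : 0 ≤ 24 ^ 4 * D)
      nlinarith
    have := le_of_mul_le_mul_left this (by positivity)
    nlinarith
  have t3 : b ^ 2 / √(D * T) ≤ ε / 24 := by
    have hs : 0 < √(D * T) := Real.sqrt_pos.2 (by positivity)
    rw [div_le_iff₀ hs]
    refine le_of_sq_le_sq ?_ (by positivity)
    rw [mul_pow (ε / 24), Real.sq_sqrt (by positivity)]
    have h3 : 24 ^ 4 * (b ^ 2 * (ε ^ 2 * b ^ 2)) ≤ T * ε ^ 4 * D := by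
      have h4 : b ^ 2 * (ε ^ 2 * b ^ 2) ≤ b ^ 2 * D ^ 2 :=
        mul_le_mul_of_nonneg_left hεb (by positivity)
      have h5 := mul_le_mul_of_nonneg_right hT hLΔ.le
      nlinarith
    have h6 : ε ^ 2 * (24 ^ 4 * b ^ 4) ≤ ε ^ 2 * (T * ε ^ 2 * D) := by linarith
    have h7 := le_of_mul_le_mul_left h6 (by positivity)
    have h8 : 0 ≤ b ^ 4 := by positivity
    nlinarith
  linarith

theorem noiseMomentum_zero_fun (β : ℝ) (t : ℕ) :
    noiseMomentum β (fun _ => (0 : Matrix (Fin m) (Fin n) ℝ)) t = 0 := by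
  induction t with
  | zero => rfl
  | succ t ih => simp [noiseMomentum, ih]

theorem deterministic_rate {β₀ : ℝ} (hβ₀ : β₀ < 1) (hL : 0 < L) (hf : IsSpectralSmooth f L)
    (hb : BddBelow (Set.range f)) (hT : 1 ≤ T) (hβ0 : 0 ≤ β) (hβ : β ≤ β₀)
    (hη : η = √(gap f W₀ / (T * L))) {M W : ℕ → Matrix (Fin m) (Fin n) ℝ}
    (h : IsDeterministicMuonRun f T η β W₀ M W) :
    avgGradient f T W ≤ (2 + 2 / (1 - β₀)) * √(L * gap f W₀ / T) := by
  have hη0 : 0 ≤ η := by rw [hη]; exact Real.sqrt_nonneg _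
  have hT1 : (1 : ℝ) ≤ T := by exact_mod_cast hT
  have hT0 : (0 : ℝ) < T := by linarith
  have hβ1 : β < 1 := hβ.trans_lt hβ₀
  have hq : 0 < 1 - β := sub_pos.2 hβ1
  have hq₀ : 0 < 1 - β₀ := sub_pos.2 hβ₀
  rw [avgGradient]
  -- With zero gap, η = 0 cannot be cancelled; but then the run stays at `W₀`, which is a minimiser,
  -- and all gradients vanish.
  rcases (gap_nonneg hb W₀).eq_or_lt with h0 | hΔ
  · have hη' : η = 0 := by rw [hη, ← h0]; simp
    have hmin : matGrad f W₀ = 0 := matGrad_eq_zero_of_forall_le fun W' => by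
      have h1 : f W₀ = ⨅ W, f W := by rw [gap] at h0; linarith
      rw [h1]
      exact ciInf_le hb W'
    have hW : ∀ t ≤ T, W t = W₀ := by
      intro t
      induction t with
      | zero => intro _; exact h.init
      | succ t ih =>
        intro ht
        obtain ⟨k, U, s, V, -, hW⟩ := h.step t (by omega)
        rw [hW, hη', zero_smul, sub_zero, ih (by omega)]
    rw [Finset.sum_eq_zero fun t ht => by
      rw [hW t (Finset.mem_range.1 ht).le, hmin, nuclearNorm_zero], mul_zero]
    positivity
  have hmain := IsMuonRun.sum_nuclearNorm_le h hf hL.le hη0 hβ0 hβ1 hb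
  simp only [sub_self, noiseMomentum_zero_fun, nuclearNorm_zero, Finset.sum_const_zero, mul_zero,
    add_zero] at hmain
  set S := ∑ t ∈ Finset.range T, nuclearNorm (matGrad f (W t))
  set Δ := gap f W₀
  set A := √(L * Δ / T)
  have hA : 0 ≤ A := Real.sqrt_nonneg _
  have hA2 : A ^ 2 = L * Δ / T := Real.sq_sqrt (by positivity)
  have hη2 : η ^ 2 = Δ / (T * L) := by rw [hη]; exact Real.sq_sqrt (by positivity)
  have hηpos : 0 < η := by rw [hη]; exact Real.sqrt_pos.2 (by positivity)
  have hLη : L * η = A := by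
    refine (pow_left_inj₀ (by positivity) (by positivity) two_ne_zero).1 ?_
    rw [mul_pow, hη2, hA2]
    field_simp
  have hΔA : Δ = η * (T * A) := by
    refine (pow_left_inj₀ hΔ.le (by positivity) two_ne_zero).1 ?_
    rw [mul_pow, mul_pow, hη2, hA2]
    field_simp
  have e1 : β * L * η / (1 - β) = β / (1 - β) * A := by rw [mul_assoc, hLη]; ring
  have e2 : L * η ^ 2 = η * A := by rw [← hLη]; ring
  have hS : S ≤ T * A + T * (2 * (β / (1 - β) * A) + A) := by
    refine le_of_mul_le_mul_left (hmain.trans (le_of_eq ?_)) hηpos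
    rw [e1, e2]
    conv_lhs => rw [hΔA]
    ring
  have h1 : β / (1 - β) ≤ 1 / (1 - β₀) := by
    gcongr
  have h2 : β / (1 - β) * (T * A) ≤ 1 / (1 - β₀) * (T * A) :=
    mul_le_mul_of_nonneg_right h1 (by positivity)
  rw [one_div, inv_mul_le_iff₀ hT0]
  have e3 : (T : ℝ) * ((2 + 2 / (1 - β₀)) * A) = 2 * (T * A) + 2 * (1 / (1 - β₀) * (T * A)) := by
    ring
  rw [e3]
  linarith

end Rates

end Muon

/-! ### Assembly of the rates and complexities. -/

theorem mainTheorem11 :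
    -- stochastic setting: rate with an absolute constant
    (∃ C : ℝ, 0 < C ∧
      ∀ (m n : ℕ) (f : Matrix (Fin m) (Fin n) ℝ → ℝ) (W₀ : Matrix (Fin m) (Fin n) ℝ) (L σ : ℝ),
        0 < L → 0 < σ → Muon.IsSpectralSmooth f L → BddBelow (Set.range f) →
      ∀ (Ξ : Type u) [MeasurableSpace Ξ] (P : Measure Ξ) [IsProbabilityMeasure P]
        (g : Matrix (Fin m) (Fin n) ℝ → Ξ → Matrix (Fin m) (Fin n) ℝ),
        Muon.IsStochasticGradient P f g σ →
      ∀ (T : ℕ) (η β : ℝ), 1 ≤ T → 0 ≤ β → β < 1 →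
        1 - β = min (√(L * Muon.gap f W₀) / (σ * √(((min m n : ℕ) : ℝ) * T))) 1 →
        η = √((1 - β) * Muon.gap f W₀ / (T * L)) →
      ∀ (Ω : Type v) [MeasurableSpace Ω] (μ : Measure Ω) [IsProbabilityMeasure μ]
        (ξ : ℕ → Fin 1 → Ω → Ξ) (M W : ℕ → Ω → Matrix (Fin m) (Fin n) ℝ),
        Muon.IsStochasticMuonRun P μ g T 1 η β W₀ ξ M W →
        Muon.HasFiniteExpectedGradients μ f T W ∧
        Muon.avgExpectedGradient μ f T W ≤
          C * ((((min m n : ℕ) : ℝ) * L * Muon.gap f W₀ * σ ^ 2 / T) ^ ((1 : ℝ) / 4)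
            + √(L * Muon.gap f W₀ / T)
            + ((min m n : ℕ) : ℝ) * σ ^ 2 / √(L * Muon.gap f W₀ * T))) ∧
    -- deterministic setting: rate, with a constant that depends only on a bound `β₀ < 1` for `β`
    (∀ β₀ : ℝ, β₀ < 1 → ∃ C : ℝ, 0 < C ∧
      ∀ (m n : ℕ) (f : Matrix (Fin m) (Fin n) ℝ → ℝ) (W₀ : Matrix (Fin m) (Fin n) ℝ) (L : ℝ),
        0 < L → Muon.IsSpectralSmooth f L → BddBelow (Set.range f) →
      ∀ (T : ℕ) (η β : ℝ), 1 ≤ T → 0 ≤ β → β ≤ β₀ →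
        η = √(Muon.gap f W₀ / (T * L)) →
      ∀ M W : ℕ → Matrix (Fin m) (Fin n) ℝ, Muon.IsDeterministicMuonRun f T η β W₀ M W →
        Muon.avgGradient f T W ≤ C * √(L * Muon.gap f W₀ / T)) ∧
    -- stochastic setting: complexity (one stochastic gradient per iteration)
    (∃ C : ℝ, 0 < C ∧
      ∀ (m n : ℕ) (f : Matrix (Fin m) (Fin n) ℝ → ℝ) (W₀ : Matrix (Fin m) (Fin n) ℝ) (L σ : ℝ),
        0 < L → 0 < σ → Muon.IsSpectralSmooth f L → BddBelow (Set.range f) →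
      ∀ ε : ℝ, 0 < ε → ε ≤ σ * √((min m n : ℕ) : ℝ) →
        ε ≤ L * Muon.gap f W₀ / (σ * √((min m n : ℕ) : ℝ)) →
      ∃ N : ℕ, 1 ≤ N ∧
        (N : ℝ) ≤ C * (((min m n : ℕ) : ℝ) * L * σ ^ 2 * Muon.gap f W₀ / ε ^ 4) ∧
      ∀ (Ξ : Type u) [MeasurableSpace Ξ] (P : Measure Ξ) [IsProbabilityMeasure P]
        (g : Matrix (Fin m) (Fin n) ℝ → Ξ → Matrix (Fin m) (Fin n) ℝ),
        Muon.IsStochasticGradient P f g σ →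
      ∀ (T : ℕ) (η β : ℝ), N ≤ T → 0 ≤ β → β < 1 →
        1 - β = min (√(L * Muon.gap f W₀) / (σ * √(((min m n : ℕ) : ℝ) * T))) 1 →
        η = √((1 - β) * Muon.gap f W₀ / (T * L)) →
      ∀ (Ω : Type v) [MeasurableSpace Ω] (μ : Measure Ω) [IsProbabilityMeasure μ]
        (ξ : ℕ → Fin 1 → Ω → Ξ) (M W : ℕ → Ω → Matrix (Fin m) (Fin n) ℝ),
        Muon.IsStochasticMuonRun P μ g T 1 η β W₀ ξ M W →
        Muon.HasFiniteExpectedGradients μ f T W ∧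
        Muon.avgExpectedGradient μ f T W ≤ ε ∧
        ∃ t < T, ∫ ω, Muon.nuclearNorm (Muon.matGrad f (W t ω)) ∂μ ≤ ε) ∧
    -- deterministic setting: complexity
    (∀ β₀ : ℝ, β₀ < 1 → ∃ C : ℝ, 0 < C ∧
      ∀ (m n : ℕ) (f : Matrix (Fin m) (Fin n) ℝ → ℝ) (W₀ : Matrix (Fin m) (Fin n) ℝ) (L : ℝ),
        0 < L → Muon.IsSpectralSmooth f L → BddBelow (Set.range f) →
      ∀ ε : ℝ, 0 < ε →
      ∃ N : ℕ, 1 ≤ N ∧ (N : ℝ) ≤ max 1 (C * (L * Muon.gap f W₀ / ε ^ 2)) ∧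
      ∀ (T : ℕ) (η β : ℝ), N ≤ T → 0 ≤ β → β ≤ β₀ →
        η = √(Muon.gap f W₀ / (T * L)) →
      ∀ M W : ℕ → Matrix (Fin m) (Fin n) ℝ, Muon.IsDeterministicMuonRun f T η β W₀ M W →
        Muon.avgGradient f T W ≤ ε ∧ ∃ t < T, Muon.IsNuclearStationary f ε (W t)) := by

  -- In 24^4 + 1, the extra 1 pays for the ceiling, since the quantity it multiplies is at least 1.
  refine ⟨⟨8, by norm_num, ?_⟩, fun β₀ hβ₀ => ?_, ⟨24 ^ 4 + 1, by norm_num, ?_⟩, fun β₀ hβ₀ => ?_⟩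
  · intro m n f W₀ L σ hL hσ hf hb Ξ _ P _ g hg T η β hT hβ0 hβ1 hβ hη Ω _ μ _ ξ M W h
    exact Muon.stochastic_rate hL hσ hf hb hg hT hβ0 hβ1 hβ hη h
  · have hq : 0 < 1 - β₀ := sub_pos.2 hβ₀
    refine ⟨2 + 2 / (1 - β₀), by positivity, ?_⟩
    intro m n f W₀ L hL hf hb T η β hT hβ0 hβ hη M W h
    exact Muon.deterministic_rate hβ₀ hL hf hb hT hβ0 hβ hη h
  · intro m n f W₀ L σ hL hσ hf hb ε hε hε1 hε2
    obtain ⟨hX, hrate⟩ := Muon.stochastic_rate_le hσ hε (Nat.cast_nonneg (min m n)) hε1 hε2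
    set X := ((min m n : ℕ) : ℝ) * L * σ ^ 2 * Muon.gap f W₀ / ε ^ 4
    have hceil := Nat.le_ceil (24 ^ 4 * X)
    have hN : 1 ≤ ⌈24 ^ 4 * X⌉₊ := Nat.one_le_ceil_iff.2 (by positivity)
    refine ⟨⌈24 ^ 4 * X⌉₊, hN, ?_, ?_⟩
    · have := Nat.ceil_lt_add_one (by positivity : 0 ≤ 24 ^ 4 * X)
      linarith
    intro Ξ _ P _ g hg T η β hT hβ0 hβ1 hβ hη Ω _ μ _ ξ M W h
    obtain ⟨hfin, havg⟩ :=
      Muon.stochastic_rate hL hσ hf hb hg (hN.trans hT) hβ0 hβ1 hβ hη h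
    have hle := havg.trans (hrate T (hceil.trans (by exact_mod_cast hT)))
    exact ⟨hfin, hle, Muon.exists_le_of_average_le (hN.trans hT) hle⟩
  · have hq : 0 < 1 - β₀ := sub_pos.2 hβ₀
    set C := 2 + 2 / (1 - β₀) with hC
    have hC0 : 0 < C := by positivity
    -- C²LΔ/ε² iterations suffice by the rate. The factor 2 covers rounding up when this number is
    -- at least 1; otherwise a single iteration is enough.
    refine ⟨2 * C ^ 2, by positivity, ?_⟩
    intro m n f W₀ L hL hf hb ε hε
    have hΔ := Muon.gap_nonneg hb W₀
    set y := C ^ 2 * (L * Muon.gap f W₀ / ε ^ 2) with hy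
    have hy0 : 0 ≤ y := by positivity
    refine ⟨max 1 ⌈y⌉₊, le_max_left _ _, ?_, ?_⟩
    · rw [mul_assoc, ← hy]
      push_cast
      refine max_le (le_max_left _ _) ?_
      rcases le_total y 1 with h1 | h1
      · exact le_max_of_le_left (by exact_mod_cast Nat.ceil_le.2 (by exact_mod_cast h1))
      · have := Nat.ceil_lt_add_one hy0
        exact le_max_of_le_right (by linarith)
    intro T η β hT hβ0 hβ hη M W h
    have hT1 : 1 ≤ T := (le_max_left _ _).trans hT
    have hT0 : (0 : ℝ) < T := by exact_mod_cast hT1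
    have hyT : y ≤ T := (Nat.le_ceil y).trans (by exact_mod_cast (le_max_right _ _).trans hT)
    have hle : Muon.avgGradient f T W ≤ ε := by
      refine (Muon.deterministic_rate hβ₀ hL hf hb hT1 hβ0 hβ hη h).trans ?_
      rw [← hC, ← le_div_iff₀' hC0, Real.sqrt_le_left (by positivity), div_le_iff₀ hT0, div_pow]
      rw [hy, ← mul_div_assoc, div_le_iff₀ (by positivity)] at hyT
      rw [div_mul_eq_mul_div, le_div_iff₀ (by positivity)]
      linarith
    exact ⟨hle, Muon.exists_le_of_average_le hT1 hle⟩
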